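/- **Setting.** Fix a smooth arclength-parametrized curve $\gamma_0:\mathbb R\to\mathbb R^3$ asymptotic at both ends to one fixed line (e.g. the line itself). Let $BAL$ be the set of smooth arclength-parametrized curves $\gamma:\mathbb R\to\mathbb R^3$ with nowhere vanishing curvature $\kappa$ and torsion $\tau$ such that (i) for some number $a$ one has $\gamma(s+a)-\gamma_0(s)\to0$ as $s\to+\infty$ and $\gamma(s-a)-\gamma_0(s)\to0$ as $s\to-\infty$; (ii) $\kappa$ is rapidly decreasing (its product with every polynomial tends to $0$ at $\pm\infty$) and $\kappa^{-1}\partial_s^n\kappa$, $\partial_s^n\tau$ ($n\ge0$) are asymptotically polynomial-like (their quotient by some nonzero polynomial tends to $0$ at $\pm\infty$). Put $\ell(\gamma)=2a$ (the renormalized length). Scalar fields are functions of $(\gamma,s)\in BAL\times\mathbb R$, functionals are functions of $\gamma$; put $\int f=\int_{-\infty}^\infty f\,ds$ and $\partial_s^{-1}f(s)=\frac12\bigl(\int_{-\infty}^s f-\int_s^\infty f\bigr)$. Let $\mathfrak A_n$ ($n\in\mathbb Z$) be the spaces of scalar fields that have an expression of degree $n$ in $\kappa$ (degree $1$), $\kappa^{-1}$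 (degree $-1$), $\tau,s,\ell,1$ (degree $0$), formed by real linear combinations, products (degrees add), $\partial_s$ (degree is kept), and $\partial_s^{-1}$ and $\int$ (from degree $2$ to degree $0$), where an expression of degree $n$ also counts as one of degree $n-1$. Let $\mathcal F$ be the algebra of functionals generated by $1$, $\ell$ and $\int f$, $f\in\mathfrak A_2$, and let $\mathcal X=\{gN+hB: g,h\in\mathfrak A_1\}$ be the space of vector fields ($T,N,B$ is the Frenet frame). For $X=gN+hB$ let $\wp X=\partial_s^{-1}(\kappa g)\,T+gN+hB$, and let $XF$ be the variational derivative of the functional $F$ in the direction $\wp X$, i.e. the derivative of $F$ along smooth one-parameter families in $BAL$ with initial velocity $\wp X$ whose velocities are of the form $\partial_s^{-1}(\kappa g)T+gN+hB$ and for which the decay of $\kappa$ and polynomial bounds on $\kappa^{-1}\partial_s^n\kappa$, $\partial_s^n\tau$, $\kappa^{-1}\partial_s^n g$, $\kappa^{-1}\partial_s^n h$ hold uniformly. A 1-form is an $\mathcal F$-linear map $\eta:\mathcal X\to\mathcal F$ such that $\eta(gN+hB)$ is given by one expression of degree $0$ as above in which $g,h$ occur as further variables of degree $1$; the differential of $F$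 is $dF(Y)=YF$. Let $\langle X,Y\rangle=\int(g_Xg_Y+h_Xh_Y)$, let $\operatorname{grad}F\in\mathcal X$ be defined by $YF=\langle\operatorname{grad}F,Y\rangle$ for all $Y$, and put $J(gN+hB)=hN-gB$, $R=J\circ\varphi\circ\nabla_s\circ\wp$, where $\nabla_s$ is the derivative along the curve and $\varphi$ drops the $T$-component, $\Omega_0(X,Y)=\langle J^{-1}X,Y\rangle$. Let $H_0$ be the map from 1-forms to $\mathcal X$ with $\langle X,H_0\eta\rangle=-\eta(JX)$ for all $X$, put $H_k=R^kH_0$ and $\{F,G\}_{H_k}=(H_k\,dF)\,G$. **Theorem.** Let $X_n=R^n(\kappa B)$ for $n\ge0$, $Y_1=s\kappa B$, and $\zeta_n=i_{X_n}\Omega_0$, that is $\zeta_n(Y)=\Omega_0(X_n,Y)$. Put $I_0=\ell$ and $I_n=\frac1{1-n}\,\zeta_{n-1}(Y_1)$ for $n\ge2$. 1. Every $\zeta_n$ is a 1-form; for $n=0,2,3,\dots$ it is exact, with $I_n\in\mathcal F$ and $\zeta_n=dI_n$. 2. The functionals $I_n$, $n=0,2,3,\dots$, are in involution for every $H_k$: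 $\{I_i,I_j\}_{H_k}=0$ for all $i,j\in\{0,2,3,\dots\}$ and all $k\ge0$. 3. For $n=0,2,3,\dots$, $X_n$ is the Hamiltonian vector field of $I_n$ with respect to $H_0$: $X_n=H_0\,dI_n=J\operatorname{grad}I_n$. 4. (The Langer–Perline formula.) For $n\ge2$ and every curve in $BAL$ the function $\partial_s^{-1}(\kappa\,g_{n-1})$ of $s$, where $X_{n-1}=g_{n-1}N+h_{n-1}B$, is integrable, and $$I_n=\frac1{n-1}\int_{-\infty}^{\infty}\partial_s^{-1}(\kappa\,g_{n-1})\,ds .$$ -/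

import Mathlib

open Filter Topology MeasureTheory
open scoped ContDiff

namespace Filament

noncomputable section

/-- Euclidean three-space. -/
abbrev E3 : Type := EuclideanSpace ℝ (Fin 3)

/-! ### Curves and the Frenet frame -/

/-- The unit tangent of an arclength-parametrized curve. -/
def tangent (γ : ℝ → E3) (s : ℝ) : E3 := deriv γ s

/-- The curvature of an arclength-parametrized curve. -/
def curvature (γ : ℝ → E3) (s : ℝ) : ℝ := ‖deriv (tangent γ) s‖

/-- The principal normal. -/
def normal (γ : ℝ → E3) (s : ℝ) : E3 := (curvature γ s)⁻¹ • deriv (tangent γ) s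

/-- The binormal, the cross product of tangent and normal. -/
def binormal (γ : ℝ → E3) (s : ℝ) : E3 :=
  WithLp.toLp 2 (crossProduct (WithLp.ofLp (tangent γ s)) (WithLp.ofLp (normal γ s)))

/-- The torsion, the binormal component of the derivative of the normal. -/
def torsion (γ : ℝ → E3) (s : ℝ) : ℝ := inner ℝ (binormal γ s) (deriv (normal γ) s)

/-- Smooth curves, infinite in both directions, parametrized by arclength. -/
structure IsArclength (γ : ℝ → E3) : Prop where
  smooth : ContDiff ℝ ∞ γ
  unit_speed : ∀ s, ‖deriv γ s‖ = 1

/-- A function is asymptotically polynomial-like if its quotient by some nonzero polynomial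
tends to zero at both ends of the line. -/
def PolyLike (f : ℝ → ℝ) : Prop :=
  ∃ P : Polynomial ℝ, P ≠ 0 ∧ Tendsto (fun s => f s / P.eval s) atTop (𝓝 0) ∧
    Tendsto (fun s => f s / P.eval s) atBot (𝓝 0)

/-- A function is rapidly decreasing if its product with every polynomial tends to zero at
both ends of the line. -/
def RapidlyDecreasing (f : ℝ → ℝ) : Prop :=
  ∀ P : Polynomial ℝ, Tendsto (fun s => f s * P.eval s) atTop (𝓝 0) ∧
    Tendsto (fun s => f s * P.eval s) atBot (𝓝 0)

/-- Reference curves: arclength-parametrized curves that are asymptotic, at both ends, to one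
fixed line `p + ℝ v`, run through in the direction `v`. The line itself is an example. -/
structure IsReferenceCurve (γ₀ : ℝ → E3) : Prop where
  arclength : IsArclength γ₀
  asymptotic : ∃ (p v : E3) (a b : ℝ), ‖v‖ = 1 ∧
    Tendsto (fun s => γ₀ s - (p + (s + a) • v)) atTop (𝓝 0) ∧
    Tendsto (fun s => γ₀ s - (p + (s + b) • v)) atBot (𝓝 0)

/-- Balanced asymptotically linear curves, relative to the reference curve `γ₀`. In the
balancing condition the number `a` is the common value of `ℓ₊` and `ℓ₋`. -/
structure IsBAL (γ₀ γ : ℝ → E3) : Prop where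
  arclength : IsArclength γ
  curvature_ne_zero : ∀ s, curvature γ s ≠ 0
  balanced : ∃ a : ℝ, Tendsto (fun s => γ (s + a) - γ₀ s) atTop (𝓝 0) ∧
    Tendsto (fun s => γ (s - a) - γ₀ s) atBot (𝓝 0)
  curvature_decay : RapidlyDecreasing (curvature γ)
  curvature_poly : ∀ n : ℕ,
    PolyLike (fun s => (curvature γ s)⁻¹ * iteratedDeriv n (curvature γ) s)
  torsion_poly : ∀ n : ℕ, PolyLike (iteratedDeriv n (torsion γ))

/-- The space of balanced asymptotically linear curves. -/
abbrev BAL (γ₀ : ℝ → E3) : Type := {γ : ℝ → E3 // IsBAL γ₀ γ}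

variable {γ₀ : ℝ → E3}

/-! ### Scalar fields and functionals -/

/-- Scalar fields on the space of curves. -/
abbrev ScalarField (γ₀ : ℝ → E3) : Type := BAL γ₀ → ℝ → ℝ

/-- Functionals, that is, scalar fields that do not depend on `s`. -/
abbrev Functional (γ₀ : ℝ → E3) : Type := BAL γ₀ → ℝ

/-- A functional regarded as a scalar field. -/
def constField (F : Functional γ₀) : ScalarField γ₀ := fun γ _ => F γ

/-- The curvature as a scalar field. -/
def kappa : ScalarField γ₀ := fun γ s => curvature γ.1 s

/-- The reciprocal of the curvature as a scalar field. -/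
def kappaInv : ScalarField γ₀ := fun γ s => (curvature γ.1 s)⁻¹

/-- The torsion as a scalar field. -/
def tau : ScalarField γ₀ := fun γ s => torsion γ.1 s

/-- The parameter as a scalar field. -/
def param : ScalarField γ₀ := fun _ s => s

/-- The renormalized length `ℓ = ℓ₊ + ℓ₋`, where `ℓ₊ = ℓ₋` by the balancing condition. -/
def ell : Functional γ₀ := fun γ => 2 * Classical.choose γ.2.balanced

/-- The anti-derivative `½ (∫_{-∞}^s f - ∫_s^∞ f)` of a function on the line. -/
def antideriv (f : ℝ → ℝ) (s : ℝ) : ℝ :=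
  (1 / 2) * ((∫ t in Set.Iic s, f t) - ∫ t in Set.Ioi s, f t)

/-- The operator `∂_s` on scalar fields. -/
def Ds (f : ScalarField γ₀) : ScalarField γ₀ := fun γ s => deriv (f γ) s

/-- The operator `∂_s⁻¹` on scalar fields. -/
def DsInv (f : ScalarField γ₀) : ScalarField γ₀ := fun γ s => antideriv (f γ) s

/-- The definite integral of a scalar field along each curve. -/
def integ (f : ScalarField γ₀) : Functional γ₀ := fun γ => ∫ t, f γ t

/-- `AlgDep v d n f` says that `p ↦ f p` can be written as an expression of degree `n` in the
variables `v i`, which have degree `d i`, and in `κ`, `κ⁻¹`, `τ`, `s`, `ℓ`, `1`, by means of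
addition, scaling, multiplication, `∂_s`, `∂_s⁻¹` and `∫`. An expression of degree `n` is also
one of degree `n - 1`, and `∂_s⁻¹` and `∫` may be applied in degree `2` and above only. -/
inductive AlgDep {P ι : Type} (v : ι → P → ScalarField γ₀) (d : ι → ℤ) :
    ℤ → (P → ScalarField γ₀) → Prop
  | var (i : ι) : AlgDep v d (d i) (v i)
  | kappa : AlgDep v d 1 (fun _ => kappa)
  | kappaInv : AlgDep v d (-1) (fun _ => kappaInv)
  | tau : AlgDep v d 0 (fun _ => tau)
  | param : AlgDep v d 0 (fun _ => param)
  | ell : AlgDep v d 0 (fun _ => constField ell)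
  | one : AlgDep v d 0 (fun _ => 1)
  | zero (n : ℤ) : AlgDep v d n (fun _ => 0)
  | add {n : ℤ} {f g : P → ScalarField γ₀} : AlgDep v d n f → AlgDep v d n g →
      AlgDep v d n (fun p => f p + g p)
  | smul {n : ℤ} {f : P → ScalarField γ₀} (c : ℝ) : AlgDep v d n f →
      AlgDep v d n (fun p => c • f p)
  | mul {i j : ℤ} {f g : P → ScalarField γ₀} : AlgDep v d i f → AlgDep v d j g →
      AlgDep v d (i + j) (fun p => f p * g p)
  | lower {n : ℤ} {f : P → ScalarField γ₀} : AlgDep v d n f → AlgDep v d (n - 1) f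
  | deriv {n : ℤ} {f : P → ScalarField γ₀} : AlgDep v d n f →
      AlgDep v d n (fun p => Ds (f p))
  | antideriv {f : P → ScalarField γ₀} : AlgDep v d 2 f → AlgDep v d 0 (fun p => DsInv (f p))
  | integ {f : P → ScalarField γ₀} : AlgDep v d 2 f →
      AlgDep v d 0 (fun p => constField (integ (f p)))

/-- The space of scalar fields having an expression (without variables) of degree `n`. -/
def alge (γ₀ : ℝ → E3) (n : ℤ) : Submodule ℝ (ScalarField γ₀) where
  carrier := {f | AlgDep (P := Unit) (ι := Empty) (fun i => i.elim) (fun i => i.elim) n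
    (fun _ => f)}
  add_mem' h h' := AlgDep.add h h'
  zero_mem' := AlgDep.zero n
  smul_mem' c _ h := AlgDep.smul c h

theorem kappa_mem : (kappa : ScalarField γ₀) ∈ alge γ₀ 1 := AlgDep.kappa
theorem tau_mem : (tau : ScalarField γ₀) ∈ alge γ₀ 0 := AlgDep.tau
theorem param_mem : (param : ScalarField γ₀) ∈ alge γ₀ 0 := AlgDep.param

theorem mul_mem {i j n : ℤ} {f g : ScalarField γ₀} (hf : f ∈ alge γ₀ i) (hg : g ∈ alge γ₀ j)
    (h : i + j = n) : f * g ∈ alge γ₀ n := by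
  subst h; exact AlgDep.mul hf hg

theorem lower_mem {n m : ℤ} {f : ScalarField γ₀} (hf : f ∈ alge γ₀ n) (h : n - 1 = m) :
    f ∈ alge γ₀ m := by
  subst h; exact AlgDep.lower hf

theorem Ds_mem {n : ℤ} {f : ScalarField γ₀} (hf : f ∈ alge γ₀ n) : Ds f ∈ alge γ₀ n :=
  AlgDep.deriv hf

theorem DsInv_mem {f : ScalarField γ₀} (hf : f ∈ alge γ₀ 2) : DsInv f ∈ alge γ₀ 0 :=
  AlgDep.antideriv hf

/-- The algebra of admissible functionals, generated by `ℓ` and the integrals of the scalar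
fields that have an expression of degree `2`. -/
def functionals (γ₀ : ℝ → E3) : Subalgebra ℝ (Functional γ₀) :=
  Algebra.adjoin ℝ ({ell} ∪ {F | ∃ f ∈ alge γ₀ 2, F = integ f})

theorem constField_mem {F : Functional γ₀} (hF : F ∈ functionals γ₀) :
    constField F ∈ alge γ₀ 0 := by
  refine Algebra.adjoin_induction (p := fun F _ => constField F ∈ alge γ₀ 0) ?_ ?_ ?_ ?_ hF
  · rintro F (hF | ⟨f, hf, rfl⟩)
    · rw [Set.mem_singleton_iff] at hF
      subst hF
      exact AlgDep.ell
    · exact AlgDep.integ hf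
  · intro c
    have h : constField (algebraMap ℝ (Functional γ₀) c) = c • (1 : ScalarField γ₀) := by
      funext γ s
      simp [constField]
    rw [h]
    exact AlgDep.smul c AlgDep.one
  · intro F G _ _ h h'
    exact AlgDep.add h h'
  · intro F G _ _ h h'
    exact mul_mem h h' (by norm_num)

/-! ### Tangent fields and vector fields -/

/-- Tangent fields `f T + g N + h B`, given by their components `(f, g, h)` in the Frenet frame,
with `f` of degree `n - 1` and `g`, `h` of degree `n`. -/
def tang (γ₀ : ℝ → E3) (n : ℤ) :
    Submodule ℝ (ScalarField γ₀ × ScalarField γ₀ × ScalarField γ₀) :=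
  (alge γ₀ (n - 1)).prod ((alge γ₀ n).prod (alge γ₀ n))

/-- The covariant derivative `∇_s` of a tangent field in components, by the Leibniz rule and the
Frenet-Serret equations `T' = κ N`, `N' = - κ T + τ B`, `B' = - τ N`. -/
def nabla {n : ℤ} (Z : tang γ₀ n) : tang γ₀ n :=
  ⟨(Ds Z.1.1 - kappa * Z.1.2.1,
    Ds Z.1.2.1 + kappa * Z.1.1 - tau * Z.1.2.2,
    Ds Z.1.2.2 + tau * Z.1.2.1), by
    obtain ⟨⟨f, g, h⟩, hf, hg, hh⟩ := Z
    refine ⟨Submodule.sub_mem _ (Ds_mem hf) ?_,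
      Submodule.sub_mem _ (Submodule.add_mem _ (Ds_mem hg) (mul_mem kappa_mem hf (by ring)))
        (mul_mem tau_mem hh (by ring)),
      Submodule.add_mem _ (Ds_mem hh) (mul_mem tau_mem hg (by ring))⟩
    exact lower_mem (lower_mem (mul_mem kappa_mem hg rfl) rfl) (by ring)⟩

/-- Vector fields `g N + h B`, given by the pairs `(g, h)` of scalar fields of degree `1`. -/
abbrev VField (γ₀ : ℝ → E3) : Type := ↥((alge γ₀ 1).prod (alge γ₀ 1))

/-- The normal component of a vector field. -/
def VField.nc (X : VField γ₀) : ScalarField γ₀ := X.1.1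

/-- The binormal component of a vector field. -/
def VField.bc (X : VField γ₀) : ScalarField γ₀ := X.1.2

/-- Multiplication of a vector field by an admissible functional. -/
def fsmul (F : functionals γ₀) (X : VField γ₀) : VField γ₀ :=
  ⟨(constField F.1 * X.1.1, constField F.1 * X.1.2),
    mul_mem (constField_mem F.2) X.2.1 (by norm_num),
    mul_mem (constField_mem F.2) X.2.2 (by norm_num)⟩

/-- The projection that forgets the tangential component. -/
def phi (Z : tang γ₀ 1) : VField γ₀ := ⟨(Z.1.2.1, Z.1.2.2), Z.2.2.1, Z.2.2.2⟩

/-- The lift `g N + h B ↦ ∂_s⁻¹(κ g) T + g N + h B`. -/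
def wp (X : VField γ₀) : tang γ₀ 1 :=
  ⟨(DsInv (kappa * X.1.1), X.1.1, X.1.2),
    DsInv_mem (mul_mem kappa_mem X.2.1 (by norm_num)), X.2.1, X.2.2⟩

/-- The complex structure `J (g N + h B) = h N - g B`. -/
def J : VField γ₀ ≃ₗ[ℝ] VField γ₀ where
  toFun X := ⟨(X.1.2, -X.1.1), X.2.2, Submodule.neg_mem _ X.2.1⟩
  invFun X := ⟨(-X.1.2, X.1.1), Submodule.neg_mem _ X.2.2, X.2.1⟩
  map_add' X Y := by
    ext1
    simp [add_comm]
  map_smul' c X := by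
    ext1
    simp
  left_inv X := by
    ext1
    simp
  right_inv X := by
    ext1
    simp

/-- The recursion operator `R = J ∘ φ ∘ ∇_s ∘ ℘`. -/
def R (X : VField γ₀) : VField γ₀ := J (phi (nabla (wp X)))

/-- The Riemannian structure. -/
def metric (X Y : VField γ₀) : Functional γ₀ := integ (X.nc * Y.nc + X.bc * Y.bc)

/-! ### Variations and the action of vector fields on functionals -/

/-- `IsPath Γ g h`: the curves `Γ ε` form a smooth one-parameter family inside the space of
balanced asymptotically linear curves. For `|ε| ≤ 1` its velocity at time `ε` is the variation
field `∂_s⁻¹(κ g) T + g N + h B` along `Γ ε` with `g = g ε`, `h = h ε`, and the decay of the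
curvature and the bounds on `κ⁻¹ ∂_sⁿ κ`, `∂_sⁿ τ`, `κ⁻¹ ∂_sⁿ g`, `κ⁻¹ ∂_sⁿ h` by polynomials
hold uniformly in `ε`. -/
structure IsPath (Γ : ℝ → BAL γ₀) (g h : ℝ → ℝ → ℝ) : Prop where
  smooth : ContDiff ℝ ∞ (fun p : ℝ × ℝ => (Γ p.1).1 p.2)
  velocity : ∀ ε : ℝ, |ε| ≤ 1 → ∀ s : ℝ, HasDerivAt (fun e => (Γ e).1 s)
    (antideriv (fun t => curvature (Γ ε).1 t * g ε t) s • tangent (Γ ε).1 s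
      + g ε s • normal (Γ ε).1 s + h ε s • binormal (Γ ε).1 s) ε
  curvature_decay : ∀ k : ℕ, ∃ C : ℝ, ∀ ε : ℝ, |ε| ≤ 1 → ∀ s : ℝ,
    |s| ^ k * curvature (Γ ε).1 s ≤ C
  curvature_bound : ∀ n : ℕ, ∃ (C : ℝ) (k : ℕ), ∀ ε : ℝ, |ε| ≤ 1 → ∀ s : ℝ,
    |iteratedDeriv n (curvature (Γ ε).1) s| ≤ C * (1 + |s|) ^ k * curvature (Γ ε).1 s
  torsion_bound : ∀ n : ℕ, ∃ (C : ℝ) (k : ℕ), ∀ ε : ℝ, |ε| ≤ 1 → ∀ s : ℝ,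
    |iteratedDeriv n (torsion (Γ ε).1) s| ≤ C * (1 + |s|) ^ k
  normal_bound : ∀ n : ℕ, ∃ (C : ℝ) (k : ℕ), ∀ ε : ℝ, |ε| ≤ 1 → ∀ s : ℝ,
    |iteratedDeriv n (g ε) s| ≤ C * (1 + |s|) ^ k * curvature (Γ ε).1 s
  binormal_bound : ∀ n : ℕ, ∃ (C : ℝ) (k : ℕ), ∀ ε : ℝ, |ε| ≤ 1 → ∀ s : ℝ,
    |iteratedDeriv n (h ε) s| ≤ C * (1 + |s|) ^ k * curvature (Γ ε).1 s

/-- `ActsAs X F D`: the variational derivative `X F` of the functional `F` in the direction of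
the vector field `X` is `D`, that is, `F` has the derivative `D γ` along every path through
`γ` whose velocity at `γ` is `℘ X`. -/
def ActsAs (X : VField γ₀) (F D : Functional γ₀) : Prop :=
  ∀ (Γ : ℝ → BAL γ₀) (g h : ℝ → ℝ → ℝ), IsPath Γ g h → g 0 = X.nc (Γ 0) → h 0 = X.bc (Γ 0) →
    HasDerivAt (fun ε => F (Γ ε)) (D (Γ 0)) 0

/-! ### Differential forms and Hamiltonian operators -/

/-- 1-forms: maps from vector fields to admissible functionals that are linear over the
admissible functionals and are given by an expression of degree `0` in the two components of the
vector field, regarded as variables of degree `1`. -/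
structure IsOneForm (η : VField γ₀ → Functional γ₀) : Prop where
  mem : ∀ U, η U ∈ functionals γ₀
  map_add : ∀ U V, η (U + V) = η U + η V
  map_fsmul : ∀ (F : functionals γ₀) (U : VField γ₀), η (fsmul F U) = F.1 * η U
  expr : AlgDep (P := VField γ₀) (ι := Fin 2) ![VField.nc, VField.bc] (fun _ => 1) 0
    (fun U => constField (η U))

/-- `IsDifferential F η`: the 1-form `η` is the exterior derivative of `F`, that is,
`η(Y) = Y F` for every vector field `Y`. -/
def IsDifferential (F : Functional γ₀) (η : VField γ₀ → Functional γ₀) : Prop :=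
  IsOneForm η ∧ ∀ Y, ActsAs Y F (η Y)

/-- `IsGradient F G`: the vector field `G` is the gradient of `F`, that is, `Y F` is the
scalar product of `G` and `Y` for every vector field `Y`. -/
def IsGradient (F : Functional γ₀) (G : VField γ₀) : Prop :=
  ∀ Y, ActsAs Y F (metric G Y)

open Classical in
/-- The Hamiltonian operator `H₀`: the vector field `H₀ η` is the one whose scalar product with
every `X` is `- η (J X)`. It is set to zero where there is none, which happens for no
1-form. -/
def H0 (η : VField γ₀ → Functional γ₀) : VField γ₀ :=
  if h : ∃ V, ∀ X, metric X V = -η (J X) then Classical.choose h else 0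

/-- The Hamiltonian operators `H_k = R^k H₀`. -/
def H (k : ℕ) (η : VField γ₀ → Functional γ₀) : VField γ₀ := R^[k] (H0 η)

/-- `IsHamiltonianField k F X`: the vector field `X` is `H_k dF`. -/
def IsHamiltonianField (k : ℕ) (F : Functional γ₀) (X : VField γ₀) : Prop :=
  ∃ η, IsDifferential F η ∧ H k η = X

/-- `IsPoisson k F G D`: the Poisson bracket `(H_k dF) G` of `F` and `G` is `D`. -/
def IsPoisson (k : ℕ) (F G D : Functional γ₀) : Prop :=
  ∃ X, IsHamiltonianField k F X ∧ ActsAs X G D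

/-- The 2-form `Ω₀`. -/
def Omega0 (X Y : VField γ₀) : Functional γ₀ := metric (J.symm X) Y

/-! ### Symmetries, master symmetries and constants of motion -/

/-- The vector field `κ B` of the vortex filament equation. -/
def kappaB : VField γ₀ := ⟨(0, kappa), Submodule.zero_mem _, kappa_mem⟩

/-- The vector field `s κ B`. -/
def sKappaB : VField γ₀ :=
  ⟨(0, param * kappa), Submodule.zero_mem _, mul_mem param_mem kappa_mem (by norm_num)⟩

/-- The symmetries `X_n = R^n (κ B)`. -/
def Xsym (n : ℕ) : VField γ₀ := R^[n] kappaB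

/-- The master symmetries `Y_n = R^(n-1) (s κ B)`, for `n ≥ 1`. -/
def Ysym (n : ℕ) : VField γ₀ := R^[n - 1] sKappaB

/-- The 1-forms `ζ_n`, the interior products of `X_n` with `Ω₀`. -/
def zeta (n : ℕ) (Y : VField γ₀) : Functional γ₀ := Omega0 (Xsym n) Y

/-- The functionals `I₀ = ℓ` and `I_n = ζ_{n-1}(Y₁) / (1 - n)` for `n ≥ 2`. The value at `n = 1`
has no meaning. -/
def consMotion : ℕ → Functional γ₀
  | 0 => ell
  | n + 1 => (1 / (1 - ((n + 1 : ℕ) : ℝ))) • zeta n (Ysym 1)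

end

end Filament

/-! Everything is read off from one sequence of fields along the curve. Put V_0 = -T and let v = Σ
x^m V_m be the formal series with v·v = 1 and x v' = T × v, that is V_m' = T × V_{m+1}
(`hasDerivAt_lax`, `sum_inner_lax`). The equation determines the part of V_{m+1} orthogonal to T,
and the unit length determines its tangential part e_m (`laxEnergy`) without any integration. Since
J acts on normal fields as -T ×, and e_n is a primitive of κ g_n that vanishes at both ends, V_{n+1}
is the lift ℘X_n (`lax_eq_lift`). Hence ∂_s⁻¹(κ g_n) = e_n decays rapidly, and ζ_n(Y) = ∫ (T ×
V_{n+1})·℘Y (`zeta_eq`).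

Involution: integrating (V_i·V_{j+1})' trades the index pair (i+1, j) for (i, j+1) until V_0, which
is parallel to T, is reached (`integral_cross_lax`); so ζ_m(X_n) = 0. The Langer–Perline formula is
integration by parts in ζ_{n-1}(sκB) = ∫ s e_{n-1}' (`consMotion_eq`).

Exactness for n ≥ 2 rests on the triple product det(v, δv, ∂_x v). The Lax equation, its
linearization and its x-derivative give x² det' = x δT·∂_x v + T·δv (`triple_lax`). The coefficients
of det decay, so those of det' integrate to zero; with δe_{n+1} = T·δV_{n+2} + δT·V_{n+2} this
yields δ∫e_{n+1} = -(n+1) ∫ δT·V_{n+2} (`integral_d₁_laxEnergy`). As δT = (δγ)', one more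
integration by parts turns the right side into (n+1) ζ_{n+2}. For n = 0, ℓ is a constant plus ∫ (1 -
T·v) with v now the asymptotic direction (`exists_ell_eq`), and its variation is a difference of
boundary values of δγ·v.

The metric is definite, so H_0 ζ_n is determined and equals X_n (`H0_zeta`). Then H_k ζ_n = X_{k+n},
and the bracket of I_i and I_j is ζ_j(X_{k+i}) = 0.

The analysis is carried by `HasDeg`: all derivatives are bounded by polynomials times a power of κ,
uniformly in a family. Degree at least one gives integrability, vanishing boundary terms and a
dominating function for differentiation under the integral. -/

namespace Filament
noncomputable section

/-! ### Cross products in three-space -/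

/-- The cross product as a continuous bilinear map. -/
def cross : E3 →L[ℝ] E3 →L[ℝ] E3 :=
  (LinearMap.mk₂ ℝ
    (fun x y : E3 => WithLp.toLp 2 (crossProduct (WithLp.ofLp x) (WithLp.ofLp y)))
    (fun x x' y => by simp) (fun c x y => by simp) (fun x y y' => by simp)
    (fun c x y => by simp)).toContinuousBilinearMap

theorem cross_eq (x y : E3) :
    cross x y = WithLp.toLp 2 (crossProduct (WithLp.ofLp x) (WithLp.ofLp y)) := rfl

@[simp] theorem cross_zero_coord (x y : E3) : cross x y 0 = x 1 * y 2 - x 2 * y 1 := by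
  simp [cross_eq, cross_apply]

@[simp] theorem cross_one_coord (x y : E3) : cross x y 1 = x 2 * y 0 - x 0 * y 2 := by
  simp [cross_eq, cross_apply]

@[simp] theorem cross_two_coord (x y : E3) : cross x y 2 = x 0 * y 1 - x 1 * y 0 := by
  simp [cross_eq, cross_apply]

theorem inner_coords (x y : E3) : inner ℝ x y = x 0 * y 0 + x 1 * y 1 + x 2 * y 2 := by
  simp [PiLp.inner_apply, Fin.sum_univ_three, mul_comm]

theorem ext_coords {x y : E3} (h0 : x 0 = y 0) (h1 : x 1 = y 1) (h2 : x 2 = y 2) : x = y := by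
  ext i
  fin_cases i
  · exact h0
  · exact h1
  · exact h2

theorem cross_self_eq_zero (x : E3) : cross x x = 0 := by
  apply ext_coords <;> simp <;> ring

theorem cross_swap (x y : E3) : cross x y = -cross y x := by
  apply ext_coords <;> simp <;> ring

theorem cross_cross_right (x y z : E3) :
    cross x (cross y z) = (inner ℝ x z : ℝ) • y - (inner ℝ x y : ℝ) • z := by
  apply ext_coords <;> simp [inner_coords] <;> ring

theorem inner_cross_left_self (x y : E3) : inner ℝ x (cross x y) = 0 := by
  simp [inner_coords]; ring

theorem inner_cross_right_self (x y : E3) : inner ℝ y (cross x y) = 0 := by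
  simp [inner_coords]; ring

theorem inner_cross_swap (x y z : E3) : inner ℝ (cross x y) z = -inner ℝ y (cross x z) := by
  simp [inner_coords]; ring

theorem inner_cross_cross (w x y z : E3) :
    inner ℝ (cross w x) (cross y z) = inner ℝ w y * inner ℝ x z - inner ℝ w z * inner ℝ x y := by
  simp [inner_coords]; ring

theorem hasDerivAt_cross {u v : ℝ → E3} {u' v' : E3} {s : ℝ} (hu : HasDerivAt u u' s)
    (hv : HasDerivAt v v' s) :
    HasDerivAt (fun t => cross (u t) (v t)) (cross (u s) v' + cross u' (v s)) s :=
  ContinuousLinearMap.hasDerivAt_of_bilinear (fun _ => hu) (fun _ => hv)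

/-! ### Orthonormal frames -/

/-- Positively oriented orthonormal frames. -/
structure IsFrame (t n b : E3) : Prop where
  tt : inner ℝ t t = (1 : ℝ)
  nn : inner ℝ n n = (1 : ℝ)
  tn : inner ℝ t n = (0 : ℝ)
  b_eq : b = cross t n

namespace IsFrame

variable {t n b : E3} (h : IsFrame t n b)

include h

theorem nt : inner ℝ n t = (0 : ℝ) := by rw [real_inner_comm, h.tn]

theorem bb : inner ℝ b b = (1 : ℝ) := by
  rw [h.b_eq, inner_cross_cross, h.tt, h.nn, h.tn, h.nt]; norm_num

theorem tb : inner ℝ t b = (0 : ℝ) := by rw [h.b_eq, inner_cross_left_self]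

theorem nb : inner ℝ n b = (0 : ℝ) := by rw [h.b_eq, inner_cross_right_self]

theorem bt : inner ℝ b t = (0 : ℝ) := by rw [real_inner_comm, h.tb]

theorem bn : inner ℝ b n = (0 : ℝ) := by rw [real_inner_comm, h.nb]

theorem cross_tb : cross t b = -n := by
  rw [h.b_eq, cross_cross_right, h.tn, h.tt]; simp

theorem cross_tn : cross t n = b := h.b_eq.symm

theorem cross_nb : cross n b = t := by
  rw [h.b_eq, cross_cross_right, h.nn, h.nt]; simp

/-- The double product b × (b × x) is evaluated in two ways, as (b·x) b - x and through b × x =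
(x·t) n - (x·n) t. -/
theorem expand (x : E3) :
    x = (inner ℝ x t : ℝ) • t + (inner ℝ x n : ℝ) • n + (inner ℝ x b : ℝ) • b := by
  have h1 : cross b (cross b x) = (inner ℝ b x : ℝ) • b - x := by
    rw [cross_cross_right, h.bb, one_smul]
  have h2 : cross b x = (inner ℝ x t : ℝ) • n - (inner ℝ x n : ℝ) • t := by
    rw [cross_swap, h.b_eq, cross_cross_right]; abel
  have h3 : cross b (cross b x) = -((inner ℝ x t : ℝ) • t) - (inner ℝ x n : ℝ) • n := by
    rw [h2, map_sub, map_smul, map_smul, cross_swap b n, cross_swap b t, h.cross_nb, h.cross_tb]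
    simp
  rw [h1, real_inner_comm] at h3
  rw [sub_eq_iff_eq_add] at h3
  rw [h3]; abel

end IsFrame

/-! ### The Frenet frame -/

variable {γ : ℝ → E3}

theorem contDiff_deriv {E : Type*} [NormedAddCommGroup E] [NormedSpace ℝ E] {f : ℝ → E}
    (hf : ContDiff ℝ ∞ f) : ContDiff ℝ ∞ (deriv f) := (contDiff_infty_iff_deriv.1 hf).2

theorem hasDerivAt_of_contDiff {E : Type*} [NormedAddCommGroup E] [NormedSpace ℝ E] {f : ℝ → E}
    (hf : ContDiff ℝ ∞ f) (s : ℝ) : HasDerivAt f (deriv f s) s :=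
  (hf.differentiable (by simp) s).hasDerivAt

/-- Arclength-parametrized curves with nowhere vanishing curvature. -/
structure IsRegular (γ : ℝ → E3) : Prop where
  arclength : IsArclength γ
  curvature_ne_zero : ∀ s, curvature γ s ≠ 0

theorem IsBAL.isRegular {γ₀ γ : ℝ → E3} (h : IsBAL γ₀ γ) : IsRegular γ :=
  ⟨h.arclength, h.curvature_ne_zero⟩

theorem IsArclength.contDiff_tangent (h : IsArclength γ) : ContDiff ℝ ∞ (tangent γ) :=
  contDiff_deriv h.smooth

theorem IsArclength.inner_tangent (h : IsArclength γ) (s : ℝ) :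
    inner ℝ (tangent γ s) (tangent γ s) = (1 : ℝ) := by
  rw [real_inner_self_eq_norm_sq, tangent, h.unit_speed]; norm_num

theorem IsArclength.inner_tangent_deriv (h : IsArclength γ) (s : ℝ) :
    inner ℝ (tangent γ s) (deriv (tangent γ) s) = (0 : ℝ) := by
  have h1 := (hasDerivAt_of_contDiff h.contDiff_tangent s).inner ℝ
    (hasDerivAt_of_contDiff h.contDiff_tangent s)
  have h2 : (fun t => inner ℝ (tangent γ t) (tangent γ t)) = fun _ => (1 : ℝ) :=
    funext h.inner_tangent
  rw [h2] at h1
  have h3 := h1.unique (hasDerivAt_const s (1 : ℝ))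
  rw [real_inner_comm (tangent γ s) (deriv (tangent γ) s)] at h3
  linarith

namespace IsRegular

variable (h : IsRegular γ)

include h

theorem curvature_pos (s : ℝ) : 0 < curvature γ s :=
  lt_of_le_of_ne (norm_nonneg _) (h.curvature_ne_zero s).symm

theorem contDiff_tangent : ContDiff ℝ ∞ (tangent γ) := h.arclength.contDiff_tangent

theorem contDiff_curvature : ContDiff ℝ ∞ (curvature γ) :=
  (contDiff_deriv h.contDiff_tangent).norm ℝ
    fun s => norm_ne_zero_iff.1 (h.curvature_ne_zero s)

theorem contDiff_normal : ContDiff ℝ ∞ (normal γ) :=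
  (h.contDiff_curvature.inv h.curvature_ne_zero).smul (contDiff_deriv h.contDiff_tangent)

theorem contDiff_binormal : ContDiff ℝ ∞ (binormal γ) :=
  cross.isBoundedBilinearMap.contDiff.comp (h.contDiff_tangent.prodMk h.contDiff_normal)

theorem contDiff_torsion : ContDiff ℝ ∞ (torsion γ) :=
  h.contDiff_binormal.inner ℝ (contDiff_deriv h.contDiff_normal)

theorem deriv_tangent (s : ℝ) : deriv (tangent γ) s = curvature γ s • normal γ s := by
  rw [normal, smul_smul, mul_inv_cancel₀ (h.curvature_ne_zero s), one_smul]

theorem isFrame (s : ℝ) : IsFrame (tangent γ s) (normal γ s) (binormal γ s) where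
  tt := h.arclength.inner_tangent s
  nn := by
    rw [real_inner_self_eq_norm_sq, normal, norm_smul, norm_inv, ← curvature,
      Real.norm_of_nonneg (h.curvature_pos s).le, inv_mul_cancel₀ (h.curvature_ne_zero s)]
    norm_num
  tn := by rw [normal, inner_smul_right, h.arclength.inner_tangent_deriv, mul_zero]
  b_eq := rfl

theorem hasDerivAt_tangent (s : ℝ) :
    HasDerivAt (tangent γ) (curvature γ s • normal γ s) s := by
  rw [← h.deriv_tangent]; exact hasDerivAt_of_contDiff h.contDiff_tangent s

/-- The tangential and normal components come from differentiating N·T = 0 and N·N = 1; the binormal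
one is the torsion by definition. -/
theorem hasDerivAt_normal (s : ℝ) :
    HasDerivAt (normal γ) (-curvature γ s • tangent γ s + torsion γ s • binormal γ s) s := by
  have hN := hasDerivAt_of_contDiff h.contDiff_normal s
  have hF := h.isFrame s
  have h1 : inner ℝ (deriv (normal γ) s) (tangent γ s) = -curvature γ s := by
    have h1 := hN.inner ℝ (h.hasDerivAt_tangent s)
    have h2 : (fun t => inner ℝ (normal γ t) (tangent γ t)) = fun _ => (0 : ℝ) :=
      funext fun t => (h.isFrame t).nt
    rw [h2, inner_smul_right, hF.nn] at h1
    linarith [h1.unique (hasDerivAt_const s (0 : ℝ))]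
  have h2 : inner ℝ (deriv (normal γ) s) (normal γ s) = (0 : ℝ) := by
    have h1 := hN.inner ℝ hN
    have h2 : (fun t => inner ℝ (normal γ t) (normal γ t)) = fun _ => (1 : ℝ) :=
      funext fun t => (h.isFrame t).nn
    rw [h2, real_inner_comm] at h1
    linarith [h1.unique (hasDerivAt_const s (1 : ℝ))]
  have h3 : inner ℝ (deriv (normal γ) s) (binormal γ s) = torsion γ s := by
    rw [real_inner_comm, torsion]
  have h4 := hF.expand (deriv (normal γ) s)
  rw [h1, h2, h3, zero_smul, add_zero] at h4
  rw [← h4]; exact hN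

theorem hasDerivAt_binormal (s : ℝ) :
    HasDerivAt (binormal γ) (-torsion γ s • normal γ s) s := by
  have h1 := hasDerivAt_cross (h.hasDerivAt_tangent s) (h.hasDerivAt_normal s)
  have hF := h.isFrame s
  have h2 : cross (tangent γ s) (-curvature γ s • tangent γ s + torsion γ s • binormal γ s)
      + cross (curvature γ s • normal γ s) (normal γ s) = -torsion γ s • normal γ s := by
    simp [hF.cross_tb, cross_self_eq_zero]
  rw [h2] at h1
  exact h1

/-- The derivative of a field along the curve in terms of its components. -/
theorem hasDerivAt_comb {f g k : ℝ → ℝ} {f' g' k' : ℝ} {s : ℝ} (hf : HasDerivAt f f' s)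
    (hg : HasDerivAt g g' s) (hk : HasDerivAt k k' s) :
    HasDerivAt (fun s => f s • tangent γ s + g s • normal γ s + k s • binormal γ s)
      ((f' - curvature γ s * g s) • tangent γ s
        + (g' + curvature γ s * f s - torsion γ s * k s) • normal γ s
        + (k' + torsion γ s * g s) • binormal γ s) s := by
  have h1 := ((hf.smul (h.hasDerivAt_tangent s)).add (hg.smul (h.hasDerivAt_normal s))).add
    (hk.smul (h.hasDerivAt_binormal s))
  refine h1.congr_deriv ?_
  module

end IsRegular

end
end Filament
namespace Filament
noncomputable section

/-! ### Antiderivatives on the line -/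

section Antideriv

variable {f F : ℝ → ℝ}

/-- The symmetric antiderivative is the one from -∞ shifted by half the total integral, so its
limits at the two ends are opposite. This normalization is what fixes the constant of integration.
-/
theorem antideriv_eq (hf : Integrable f) (s : ℝ) :
    antideriv f s = (∫ t in Set.Iic s, f t) - (1 / 2) * ∫ t, f t := by
  rw [← intervalIntegral.integral_Iic_add_Ioi (b := s) hf.integrableOn hf.integrableOn, antideriv]
  ring

theorem integral_Iic_eq (hf : Integrable f) (s : ℝ) :
    (∫ t in Set.Iic s, f t) = (∫ t in Set.Iic 0, f t) + ∫ t in (0 : ℝ)..s, f t := by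
  rw [← intervalIntegral.integral_Iic_sub_Iic hf.integrableOn hf.integrableOn]
  ring

theorem hasDerivAt_antideriv (hf : Integrable f) (hc : Continuous f) (s : ℝ) :
    HasDerivAt (antideriv f) (f s) s := by
  have h1 : antideriv f = fun s => (∫ t in Set.Iic 0, f t) + (∫ t in (0 : ℝ)..s, f t)
      - (1 / 2) * ∫ t, f t := by
    funext s
    rw [antideriv_eq hf, integral_Iic_eq hf]
  rw [h1]
  exact ((intervalIntegral.integral_hasDerivAt_right (hc.intervalIntegrable _ _)
    (hc.stronglyMeasurableAtFilter _ _) hc.continuousAt).const_add _).sub_const _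

theorem tendsto_antideriv_atTop (hf : Integrable f) :
    Tendsto (antideriv f) atTop (𝓝 ((1 / 2) * ∫ t, f t)) := by
  have h1 : antideriv f = fun s => (∫ t in Set.Iic 0, f t) + (∫ t in (0 : ℝ)..s, f t)
      - (1 / 2) * ∫ t, f t := by
    funext s
    rw [antideriv_eq hf, integral_Iic_eq hf]
  rw [h1]
  have h2 := ((intervalIntegral_tendsto_integral_Ioi 0 hf.integrableOn tendsto_id).const_add
    (∫ t in Set.Iic 0, f t)).sub_const ((1 / 2) * ∫ t, f t)
  rw [intervalIntegral.integral_Iic_add_Ioi hf.integrableOn hf.integrableOn,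
    show (∫ t, f t) - 1 / 2 * ∫ t, f t = 1 / 2 * ∫ t, f t by ring] at h2
  exact h2

theorem tendsto_antideriv_atBot (hf : Integrable f) :
    Tendsto (antideriv f) atBot (𝓝 (-((1 / 2) * ∫ t, f t))) := by
  have h1 : antideriv f = fun s => (∫ t in Set.Iic 0, f t) - (∫ t in s..(0 : ℝ), f t)
      - (1 / 2) * ∫ t, f t := by
    funext s
    rw [antideriv_eq hf, integral_Iic_eq hf, intervalIntegral.integral_symm]
    ring
  rw [h1]
  have h2 := ((intervalIntegral_tendsto_integral_Iic 0 hf.integrableOn tendsto_id).const_sub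
    (∫ t in Set.Iic 0, f t)).sub_const ((1 / 2) * ∫ t, f t)
  rw [sub_self, zero_sub] at h2
  exact h2

theorem antideriv_eq_of_hasDerivAt (hf : Integrable f) (hF : ∀ s, HasDerivAt F (f s) s)
    (htop : Tendsto F atTop (𝓝 0)) (hbot : Tendsto F atBot (𝓝 0)) : antideriv f = F := by
  funext s
  rw [antideriv, integral_Iic_of_hasDerivAt_of_tendsto' (fun x _ => hF x) hf.integrableOn hbot,
    integral_Ioi_of_hasDerivAt_of_tendsto' (fun x _ => hF x) hf.integrableOn htop]
  ring

/-- The constant π is the integral of 1/(1 + s²). The bound depends on C only, hence is uniform in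
families. -/
theorem abs_antideriv_le {C : ℝ} (hf : Integrable f) (hC : ∀ s, |f s| ≤ C * (1 + s ^ 2)⁻¹) (s : ℝ) :
    |antideriv f s| ≤ C * Real.pi := by
  have hI : ∫ t, |f t| ≤ C * Real.pi := by
    rw [← integral_univ_inv_one_add_sq, ← integral_const_mul]
    exact integral_mono hf.abs (integrable_inv_one_add_sq.const_mul C) hC
  have h0 : 0 ≤ ∫ t, |f t| := integral_nonneg fun t => abs_nonneg _
  have h1 : |∫ t in Set.Iic s, f t| ≤ ∫ t, |f t| :=
    (abs_integral_le_integral_abs).trans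
      (setIntegral_le_integral hf.abs (ae_of_all _ fun t => abs_nonneg _))
  have h2 : |∫ t in Set.Ioi s, f t| ≤ ∫ t, |f t| :=
    (abs_integral_le_integral_abs).trans
      (setIntegral_le_integral hf.abs (ae_of_all _ fun t => abs_nonneg _))
  rw [antideriv, abs_mul, abs_of_pos (by norm_num : (0 : ℝ) < 1 / 2)]
  have h3 := abs_sub (∫ t in Set.Iic s, f t) (∫ t in Set.Ioi s, f t)
  linarith

end Antideriv

/-! ### Families of functions of given degree with respect to a weight -/

set_option linter.unusedSectionVars false

variable {A : Type} {E F G : Type*} [NormedAddCommGroup E] [NormedSpace ℝ E]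
  [NormedAddCommGroup F] [NormedSpace ℝ F] [NormedAddCommGroup G] [NormedSpace ℝ G]
  {K : A → ℝ → ℝ} {n m : ℤ} {l : ℕ}

/-- The functions `f a` are bounded, uniformly in `a`, by a polynomial times `K a ^ n`. -/
def PolyBound (K : A → ℝ → ℝ) (n : ℤ) (f : A → ℝ → E) : Prop :=
  ∃ (C : ℝ) (k : ℕ), 0 ≤ C ∧ ∀ a s, ‖f a s‖ ≤ C * (1 + |s|) ^ k * K a s ^ n

/-- The derivatives up to order `l` of the functions `f a` are bounded, uniformly in `a`, by
polynomials times `K a ^ n`. -/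
def OrderBound (K : A → ℝ → ℝ) (n : ℤ) : ℕ → (A → ℝ → E) → Prop
  | 0, f => PolyBound K n f
  | l + 1, f => PolyBound K n f ∧ OrderBound K n l (fun a => deriv (f a))

/-- Smooth functions `f a` all of whose derivatives are bounded, uniformly in `a`, by polynomials
times `K a ^ n`. -/
structure HasDeg (K : A → ℝ → ℝ) (n : ℤ) (f : A → ℝ → E) : Prop where
  smooth : ∀ a, ContDiff ℝ ∞ (f a)
  bound : ∀ l, OrderBound K n l f

/-- Weights: positive functions `K a` that are rapidly decreasing and of degree one with respect
to themselves. -/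
structure IsWeight (K : A → ℝ → ℝ) : Prop where
  pos : ∀ a s, 0 < K a s
  decay : ∀ k : ℕ, ∃ C : ℝ, ∀ a s, |s| ^ k * K a s ≤ C
  deg : HasDeg K 1 K

/-- Decay is assumed against |s|^k, whereas the bounds use powers of 1 + |s|, which never vanish and
grow with the exponent. The two are compared separately for |s| ≤ 1 and |s| ≥ 1. -/
theorem IsWeight.decay' (hK : IsWeight K) (k : ℕ) :
    ∃ C : ℝ, 0 ≤ C ∧ ∀ a s, (1 + |s|) ^ k * K a s ≤ C := by
  obtain ⟨C, hC⟩ := hK.decay k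
  obtain ⟨C₀, hC₀⟩ := hK.decay 0
  have key : ∀ a s, (1 + |s|) ^ k * K a s ≤ 2 ^ k * (C₀ + C) := by
    intro a s
    have h1 : (1 + |s|) ^ k ≤ 2 ^ k * (1 + |s| ^ k) := by
      rcases le_total |s| 1 with h | h
      · have : (1 + |s|) ^ k ≤ 2 ^ k := by gcongr; linarith
        refine this.trans (le_mul_of_one_le_right (by positivity) ?_)
        have : 0 ≤ |s| ^ k := by positivity
        linarith
      · have : (1 + |s|) ^ k ≤ (2 * |s|) ^ k := by gcongr; linarith
        rw [mul_pow] at this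
        refine this.trans ?_
        gcongr
        linarith
    have h2 := hC a s
    have h3 := hC₀ a s
    rw [pow_zero, one_mul] at h3
    calc (1 + |s|) ^ k * K a s ≤ 2 ^ k * (1 + |s| ^ k) * K a s := by
          gcongr
          exact (hK.pos a s).le
      _ = 2 ^ k * (K a s + |s| ^ k * K a s) := by ring
      _ ≤ 2 ^ k * (C₀ + C) := by gcongr
  refine ⟨|2 ^ k * (C₀ + C)|, abs_nonneg _, fun a s => (key a s).trans (le_abs_self _)⟩

namespace PolyBound

theorem zero : PolyBound K n (fun _ _ => (0 : E)) :=
  ⟨0, 0, le_rfl, fun a s => by simp⟩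

theorem add (hK : ∀ a s, 0 < K a s) {f g : A → ℝ → E} (hf : PolyBound K n f)
    (hg : PolyBound K n g) : PolyBound K n (fun a s => f a s + g a s) := by
  obtain ⟨C, k, hC, h⟩ := hf
  obtain ⟨C', k', hC', h'⟩ := hg
  refine ⟨C + C', k + k', by positivity, fun a s => (norm_add_le _ _).trans ?_⟩
  have h1 : (1 : ℝ) ≤ 1 + |s| := by linarith [abs_nonneg s]
  have hp : 0 ≤ K a s ^ n := (zpow_pos (hK a s) n).le
  calc ‖f a s‖ + ‖g a s‖ ≤ C * (1 + |s|) ^ k * K a s ^ n + C' * (1 + |s|) ^ k' * K a s ^ n :=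
        add_le_add (h a s) (h' a s)
    _ ≤ C * (1 + |s|) ^ (k + k') * K a s ^ n + C' * (1 + |s|) ^ (k + k') * K a s ^ n := by
        gcongr <;> first | exact h1 | omega
    _ = _ := by ring

theorem bilin (hK : ∀ a s, 0 < K a s) (B : E →L[ℝ] F →L[ℝ] G) {f : A → ℝ → E} {g : A → ℝ → F}
    (hf : PolyBound K n f) (hg : PolyBound K m g) :
    PolyBound K (n + m) (fun a s => B (f a s) (g a s)) := by
  obtain ⟨C, k, hC, h⟩ := hf
  obtain ⟨C', k', hC', h'⟩ := hg
  refine ⟨‖B‖ * C * C', k + k', by positivity, fun a s => (B.le_opNorm₂ _ _).trans ?_⟩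
  have hp : 0 ≤ K a s ^ n := (zpow_pos (hK a s) n).le
  calc ‖B‖ * ‖f a s‖ * ‖g a s‖
      ≤ ‖B‖ * (C * (1 + |s|) ^ k * K a s ^ n) * (C' * (1 + |s|) ^ k' * K a s ^ m) := by
        gcongr
        · exact h a s
        · exact h' a s
    _ = _ := by rw [zpow_add₀ (hK a s).ne', pow_add]; ring

theorem const_smul (c : ℝ) {f : A → ℝ → E} (hf : PolyBound K n f) :
    PolyBound K n (fun a s => c • f a s) := by
  obtain ⟨C, k, hC, h⟩ := hf
  refine ⟨|c| * C, k, by positivity, fun a s => ?_⟩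
  rw [norm_smul, Real.norm_eq_abs, mul_assoc, mul_assoc, ← mul_assoc C]
  gcongr
  exact h a s

/-- A weight is bounded (its decay with exponent 0), so one factor K can be absorbed in the
constant. -/
theorem lower (hK : IsWeight K) {f : A → ℝ → E} (hf : PolyBound K n f) :
    PolyBound K (n - 1) f := by
  obtain ⟨C, k, hC, h⟩ := hf
  obtain ⟨D, hD0, hD⟩ := hK.decay' 0
  refine ⟨C * D, k, by positivity, fun a s => (h a s).trans ?_⟩
  have h1 : K a s ^ n = K a s ^ (n - 1) * K a s := by
    rw [← zpow_add_one₀ (hK.pos a s).ne', sub_add_cancel]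
  have h2 := hD a s
  rw [pow_zero, one_mul] at h2
  have hp : 0 ≤ K a s ^ (n - 1) := (zpow_pos (hK.pos a s) _).le
  rw [h1]
  calc C * (1 + |s|) ^ k * (K a s ^ (n - 1) * K a s)
      ≤ C * (1 + |s|) ^ k * (K a s ^ (n - 1) * D) := by gcongr
    _ = _ := by ring

end PolyBound

namespace OrderBound

theorem pred {f : A → ℝ → E} (hf : OrderBound K n (l + 1) f) : OrderBound K n l f := by
  induction l generalizing f with
  | zero => exact hf.1
  | succ l ih => exact ⟨hf.1, ih hf.2⟩

theorem zero (l : ℕ) : OrderBound K n l (fun _ _ => (0 : E)) := by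
  induction l with
  | zero => exact PolyBound.zero
  | succ l ih => exact ⟨PolyBound.zero, by simpa using ih⟩

theorem add (hK : ∀ a s, 0 < K a s) {f g : A → ℝ → E} (sf : ∀ a, ContDiff ℝ ∞ (f a))
    (sg : ∀ a, ContDiff ℝ ∞ (g a)) (hf : OrderBound K n l f) (hg : OrderBound K n l g) :
    OrderBound K n l (fun a s => f a s + g a s) := by
  induction l generalizing f g with
  | zero => exact PolyBound.add hK hf hg
  | succ l ih =>
    refine ⟨PolyBound.add hK hf.1 hg.1, ?_⟩
    have h1 : (fun a => deriv (fun s => f a s + g a s)) =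
        fun a s => deriv (f a) s + deriv (g a) s := by
      funext a s
      exact ((hasDerivAt_of_contDiff (sf a) s).add (hasDerivAt_of_contDiff (sg a) s)).deriv
    rw [h1]
    exact ih (fun a => contDiff_deriv (sf a)) (fun a => contDiff_deriv (sg a)) hf.2 hg.2

theorem const_smul (c : ℝ) {f : A → ℝ → E}
    (sf : ∀ a, ContDiff ℝ ∞ (f a)) (hf : OrderBound K n l f) :
    OrderBound K n l (fun a s => c • f a s) := by
  induction l generalizing f with
  | zero => exact PolyBound.const_smul c hf
  | succ l ih =>
    refine ⟨PolyBound.const_smul c hf.1, ?_⟩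
    have h1 : (fun a => deriv (fun s => c • f a s)) = fun a s => c • deriv (f a) s := by
      funext a s
      exact ((hasDerivAt_of_contDiff (sf a) s).const_smul c).deriv
    rw [h1]
    exact ih (fun a => contDiff_deriv (sf a)) hf.2

/-- Induction on the order by the Leibniz rule; in each term the undifferentiated factor gives up
one order of its bound. A general bilinear map covers products, scalar multiples, inner and cross
products at once. -/
theorem bilin (hK : ∀ a s, 0 < K a s) (B : E →L[ℝ] F →L[ℝ] G) {f : A → ℝ → E} {g : A → ℝ → F}
    (sf : ∀ a, ContDiff ℝ ∞ (f a)) (sg : ∀ a, ContDiff ℝ ∞ (g a)) (hf : OrderBound K n l f)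
    (hg : OrderBound K m l g) : OrderBound K (n + m) l (fun a s => B (f a s) (g a s)) := by
  induction l generalizing f g with
  | zero => exact PolyBound.bilin hK B hf hg
  | succ l ih =>
    refine ⟨PolyBound.bilin hK B hf.1 hg.1, ?_⟩
    have h1 : (fun a => deriv (fun s => B (f a s) (g a s))) =
        fun a s => B (f a s) (deriv (g a) s) + B (deriv (f a) s) (g a s) := by
      funext a s
      exact (ContinuousLinearMap.hasDerivAt_of_bilinear
        (fun _ => hasDerivAt_of_contDiff (sf a) s)
        (fun _ => hasDerivAt_of_contDiff (sg a) s)).deriv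
    rw [h1]
    have sf' := fun a => contDiff_deriv (sf a)
    have sg' := fun a => contDiff_deriv (sg a)
    refine add hK (fun a => ?_) (fun a => ?_) (ih sf sg' hf.pred hg.2) (ih sf' sg hf.2 hg.pred)
    · exact B.isBoundedBilinearMap.contDiff.comp ((sf a).prodMk (sg' a))
    · exact B.isBoundedBilinearMap.contDiff.comp ((sf' a).prodMk (sg a))

theorem lower (hK : IsWeight K) {f : A → ℝ → E} (hf : OrderBound K n l f) :
    OrderBound K (n - 1) l f := by
  induction l generalizing f with
  | zero => exact PolyBound.lower hK hf
  | succ l ih => exact ⟨PolyBound.lower hK hf.1, ih hf.2⟩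

theorem of_iteratedDeriv (hK : ∀ a s, 0 < K a s) {f : A → ℝ → ℝ}
    (hf : ∀ j : ℕ, ∃ (C : ℝ) (k : ℕ), ∀ a s,
      |iteratedDeriv j (f a) s| ≤ C * (1 + |s|) ^ k * K a s ^ n) (l : ℕ) :
    OrderBound K n l f := by
  have h0 : PolyBound K n f := by
    obtain ⟨C, k, h⟩ := hf 0
    refine ⟨|C|, k, abs_nonneg C, fun a s => ?_⟩
    have hp : 0 ≤ K a s ^ n := (zpow_pos (hK a s) n).le
    have h1 := h a s
    rw [iteratedDeriv_zero] at h1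
    rw [Real.norm_eq_abs]
    refine h1.trans ?_
    gcongr
    exact le_abs_self C
  induction l generalizing f with
  | zero => exact h0
  | succ l ih =>
    have hf' : ∀ j : ℕ, ∃ (C : ℝ) (k : ℕ), ∀ a s,
        |iteratedDeriv j (deriv (f a)) s| ≤ C * (1 + |s|) ^ k * K a s ^ n := by
      intro j
      obtain ⟨C, k, h⟩ := hf (j + 1)
      refine ⟨C, k, fun a s => ?_⟩
      rw [← iteratedDeriv_succ']
      exact h a s
    refine ⟨h0, ih hf' ?_⟩
    obtain ⟨C, k, h⟩ := hf' 0
    refine ⟨|C|, k, abs_nonneg C, fun a s => ?_⟩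
    have hp : 0 ≤ K a s ^ n := (zpow_pos (hK a s) n).le
    have h1 := h a s
    rw [iteratedDeriv_zero] at h1
    rw [Real.norm_eq_abs]
    refine h1.trans ?_
    gcongr
    exact le_abs_self C

end OrderBound

namespace HasDeg

theorem polyBound {f : A → ℝ → E} (hf : HasDeg K n f) : PolyBound K n f := hf.bound 0

theorem zero : HasDeg K n (fun _ _ => (0 : E)) :=
  ⟨fun _ => contDiff_const, OrderBound.zero⟩

theorem add (hK : ∀ a s, 0 < K a s) {f g : A → ℝ → E} (hf : HasDeg K n f) (hg : HasDeg K n g) :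
    HasDeg K n (fun a s => f a s + g a s) :=
  ⟨fun a => (hf.smooth a).add (hg.smooth a),
    fun l => OrderBound.add hK hf.smooth hg.smooth (hf.bound l) (hg.bound l)⟩

theorem const_smul (c : ℝ) {f : A → ℝ → E} (hf : HasDeg K n f) :
    HasDeg K n (fun a s => c • f a s) :=
  ⟨fun a => contDiff_const.smul (hf.smooth a),
    fun l => OrderBound.const_smul c hf.smooth (hf.bound l)⟩

theorem neg {f : A → ℝ → E} (hf : HasDeg K n f) :
    HasDeg K n (fun a s => -f a s) := by
  simpa using hf.const_smul (-1)

theorem sub (hK : ∀ a s, 0 < K a s) {f g : A → ℝ → E} (hf : HasDeg K n f) (hg : HasDeg K n g) :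
    HasDeg K n (fun a s => f a s - g a s) := by
  simpa [sub_eq_add_neg] using hf.add hK hg.neg

theorem sum (hK : ∀ a s, 0 < K a s) {ι : Type*} {t : Finset ι} {f : ι → A → ℝ → E}
    (hf : ∀ i ∈ t, HasDeg K n (f i)) : HasDeg K n (fun a s => ∑ i ∈ t, f i a s) := by
  classical
  induction t using Finset.induction_on with
  | empty => simpa using zero
  | insert i t hi ih =>
    simp only [Finset.sum_insert hi]
    exact add hK (hf i (Finset.mem_insert_self i t))
      (ih fun j hj => hf j (Finset.mem_insert_of_mem hj))

theorem bilin (hK : ∀ a s, 0 < K a s) (B : E →L[ℝ] F →L[ℝ] G) {f : A → ℝ → E} {g : A → ℝ → F}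
    (hf : HasDeg K n f) (hg : HasDeg K m g) :
    HasDeg K (n + m) (fun a s => B (f a s) (g a s)) :=
  ⟨fun a => B.isBoundedBilinearMap.contDiff.comp ((hf.smooth a).prodMk (hg.smooth a)),
    fun l => OrderBound.bilin hK B hf.smooth hg.smooth (hf.bound l) (hg.bound l)⟩

theorem smul (hK : ∀ a s, 0 < K a s) {f : A → ℝ → ℝ} {g : A → ℝ → E}
    (hf : HasDeg K n f) (hg : HasDeg K m g) : HasDeg K (n + m) (fun a s => f a s • g a s) :=
  hf.bilin hK (ContinuousLinearMap.lsmul ℝ ℝ) hg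

theorem mul (hK : ∀ a s, 0 < K a s) {f g : A → ℝ → ℝ}
    (hf : HasDeg K n f) (hg : HasDeg K m g) : HasDeg K (n + m) (fun a s => f a s * g a s) :=
  hf.smul hK hg

theorem inner (hK : ∀ a s, 0 < K a s) {f g : A → ℝ → E3}
    (hf : HasDeg K n f) (hg : HasDeg K m g) :
    HasDeg K (n + m) (fun a s => inner ℝ (f a s) (g a s)) :=
  hf.bilin hK (innerSL ℝ) hg

theorem cross (hK : ∀ a s, 0 < K a s) {f g : A → ℝ → E3}
    (hf : HasDeg K n f) (hg : HasDeg K m g) :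
    HasDeg K (n + m) (fun a s => Filament.cross (f a s) (g a s)) :=
  hf.bilin hK Filament.cross hg

theorem lower (hK : IsWeight K) {f : A → ℝ → E} (hf : HasDeg K n f) : HasDeg K (n - 1) f :=
  ⟨hf.smooth, fun l => (hf.bound l).lower hK⟩

theorem of_le (hK : IsWeight K) {f : A → ℝ → E} (hf : HasDeg K n f) (h : m ≤ n) :
    HasDeg K m f := by
  obtain ⟨j, hj⟩ := Int.eq_ofNat_of_zero_le (sub_nonneg.2 h)
  obtain rfl : m = n - j := by omega
  clear h hj
  induction j with
  | zero => simpa using hf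
  | succ j ih =>
    have h1 := ih.lower hK
    rwa [sub_sub, ← Nat.cast_succ] at h1

theorem deriv {f : A → ℝ → E} (hf : HasDeg K n f) : HasDeg K n (fun a => deriv (f a)) :=
  ⟨fun a => contDiff_deriv (hf.smooth a), fun l => (hf.bound (l + 1)).2⟩

/-- Reduces the degree of constants, of the parameter and of antiderivatives to a bound on the
function itself, their derivatives being already understood. -/
theorem of_deriv {f : A → ℝ → E} (hs : ∀ a, ContDiff ℝ ∞ (f a)) (h0 : PolyBound K n f)
    (hf : HasDeg K n (fun a => _root_.deriv (f a))) : HasDeg K n f :=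
  ⟨hs, fun l => OrderBound.pred (l := l) ⟨h0, hf.bound l⟩⟩

theorem of_iteratedDeriv (hK : ∀ a s, 0 < K a s) {f : A → ℝ → ℝ}
    (hs : ∀ a, ContDiff ℝ ∞ (f a))
    (hf : ∀ j : ℕ, ∃ (C : ℝ) (k : ℕ), ∀ a s,
      |iteratedDeriv j (f a) s| ≤ C * (1 + |s|) ^ k * K a s ^ n) : HasDeg K n f :=
  ⟨hs, OrderBound.of_iteratedDeriv hK hf⟩

theorem const {c : A → E} {C : ℝ} (hC : ∀ a, ‖c a‖ ≤ C) :
    HasDeg K 0 (fun a _ => c a) := by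
  refine of_deriv (fun _ => contDiff_const) ⟨|C|, 0, abs_nonneg C, fun a s => ?_⟩ ?_
  · simpa using (hC a).trans (le_abs_self C)
  · simpa using zero

theorem id : HasDeg K 0 (fun _ s => s) := by
  refine of_deriv (fun _ => contDiff_id) ⟨1, 1, zero_le_one, fun a s => ?_⟩ ?_
  · simp
  · have h1 : (fun _ : A => _root_.deriv fun s : ℝ => s) = fun _ _ => (1 : ℝ) := by
      funext a s
      exact deriv_id s
    rw [h1]
    exact const (C := 1) fun a => by simp

/-- With (1/K)' = -(1/K)(1/K)K', the bound of order l for 1/K yields that of order l + 1; the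
degrees add up to -1 - 1 + 1 = -1. -/
theorem inv (hK : IsWeight K) : HasDeg K (-1) (fun a s => (K a s)⁻¹) := by
  have hs : ∀ a, ContDiff ℝ ∞ (fun s => (K a s)⁻¹) :=
    fun a => (hK.deg.smooth a).inv fun s => (hK.pos a s).ne'
  have h0 : PolyBound K (-1) (fun a s => (K a s)⁻¹) := by
    refine ⟨1, 0, zero_le_one, fun a s => ?_⟩
    rw [norm_inv, Real.norm_of_nonneg (hK.pos a s).le, zpow_neg_one]
    simp
  refine ⟨hs, fun l => ?_⟩
  induction l with
  | zero => exact h0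
  | succ l ih =>
    refine ⟨h0, ?_⟩
    have h1 : (fun a => _root_.deriv (fun s => (K a s)⁻¹)) =
        fun a s => (-1 : ℝ) • ((K a s)⁻¹ * (K a s)⁻¹ * _root_.deriv (K a) s) := by
      funext a s
      rw [((hasDerivAt_of_contDiff (hK.deg.smooth a) s).fun_inv (hK.pos a s).ne').deriv]
      have := (hK.pos a s).ne'
      simp only [smul_eq_mul]
      field_simp
    rw [h1]
    have hd := hK.deg.deriv
    have h2 := OrderBound.bilin hK.pos (ContinuousLinearMap.lsmul ℝ ℝ) hs hs ih ih
    have h3 := OrderBound.bilin hK.pos (ContinuousLinearMap.lsmul ℝ ℝ)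
      (fun a => (hs a).mul (hs a)) hd.smooth h2 (hd.bound l)
    exact OrderBound.const_smul (-1)
      (fun a => ((hs a).mul (hs a)).mul (hd.smooth a)) h3

/-! #### Decay in positive degree -/

/-- One factor K outweighs the polynomial and two further powers of 1 + |s|. The constant does not
depend on the member of the family, as dominated convergence along paths requires. -/
theorem rapid (hK : IsWeight K) {f : A → ℝ → E} (hf : HasDeg K n f) (hn : 1 ≤ n) :
    ∃ C : ℝ, 0 ≤ C ∧ ∀ a s, ‖f a s‖ ≤ C * (1 + s ^ 2)⁻¹ := by
  obtain ⟨C, k, hC, h⟩ := (hf.of_le hK hn).polyBound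
  obtain ⟨D, hD, h'⟩ := hK.decay' (k + 2)
  refine ⟨C * D, by positivity, fun a s => (h a s).trans ?_⟩
  rw [zpow_one, le_mul_inv_iff₀ (by positivity)]
  have h1 : 1 + s ^ 2 ≤ (1 + |s|) ^ 2 := by
    rw [← sq_abs s]; nlinarith [abs_nonneg s]
  have hp := (hK.pos a s).le
  calc C * (1 + |s|) ^ k * K a s * (1 + s ^ 2)
      ≤ C * (1 + |s|) ^ k * K a s * (1 + |s|) ^ 2 := by gcongr
    _ = C * ((1 + |s|) ^ (k + 2) * K a s) := by ring
    _ ≤ C * D := by gcongr; exact h' a s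

theorem integrable (hK : IsWeight K) {f : A → ℝ → E} (hf : HasDeg K n f) (hn : 1 ≤ n) (a : A) :
    Integrable (f a) := by
  obtain ⟨C, _, h⟩ := hf.rapid hK hn
  exact (integrable_inv_one_add_sq.const_mul C).mono'
    (hf.smooth a).continuous.aestronglyMeasurable (ae_of_all _ (h a))

theorem tendsto_zero_atTop (hK : IsWeight K) {f : A → ℝ → E} (hf : HasDeg K n f) (hn : 1 ≤ n)
    (a : A) : Tendsto (f a) atTop (𝓝 0) :=
  tendsto_zero_of_hasDerivAt_of_integrableOn_Ioi (a := 0)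
    (fun s _ => hasDerivAt_of_contDiff (hf.smooth a) s)
    (hf.deriv.integrable hK hn a).integrableOn (hf.integrable hK hn a).integrableOn

theorem tendsto_zero_atBot (hK : IsWeight K) {f : A → ℝ → E} (hf : HasDeg K n f) (hn : 1 ≤ n)
    (a : A) : Tendsto (f a) atBot (𝓝 0) :=
  tendsto_zero_of_hasDerivAt_of_integrableOn_Iic (a := 0)
    (fun s _ => hasDerivAt_of_contDiff (hf.smooth a) s)
    (hf.deriv.integrable hK hn a).integrableOn (hf.integrable hK hn a).integrableOn

/-- The form in which integration by parts is used: the product to be differentiated has positive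
degree, so it leaves no boundary terms. -/
theorem integral_deriv_eq_zero (hK : IsWeight K) {f : A → ℝ → ℝ} (hf : HasDeg K n f)
    (hn : 1 ≤ n) (a : A) {f' : ℝ → ℝ} (h : ∀ s, HasDerivAt (f a) (f' s) s) : ∫ s, f' s = 0 := by
  have h1 : f' = _root_.deriv (f a) := funext fun s => (h s).deriv.symm
  subst h1
  rw [integral_of_hasDerivAt_of_tendsto h (hf.deriv.integrable hK hn a)
    (hf.tendsto_zero_atBot hK hn a) (hf.tendsto_zero_atTop hK hn a), sub_zero]

theorem hasDerivAt_antideriv (hK : IsWeight K) {f : A → ℝ → ℝ} (hf : HasDeg K n f)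
    (hn : 1 ≤ n) (a : A) (s : ℝ) : HasDerivAt (antideriv (f a)) (f a s) s :=
  Filament.hasDerivAt_antideriv (hf.integrable hK hn a) (hf.smooth a).continuous s

theorem antideriv (hK : IsWeight K) {f : A → ℝ → ℝ} (hf : HasDeg K n f) (hn : 1 ≤ n) :
    HasDeg K 0 (fun a => antideriv (f a)) := by
  have h1 := hf.hasDerivAt_antideriv hK hn
  have h2 : (fun a => _root_.deriv (Filament.antideriv (f a))) = f :=
    funext fun a => funext fun s => (h1 a s).deriv
  refine of_deriv (fun a => ?_) ?_ ?_
  · refine contDiff_infty_iff_deriv.2 ⟨fun s => (h1 a s).differentiableAt, ?_⟩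
    rw [congrFun h2 a]
    exact hf.smooth a
  · obtain ⟨C, hC, h⟩ := hf.rapid hK hn
    refine ⟨C * Real.pi, 0, by positivity, fun a s => ?_⟩
    simpa using abs_antideriv_le (hf.integrable hK hn a) (h a) s
  · rw [h2]
    exact hf.of_le hK (by omega)

end HasDeg

end
end Filament
namespace Filament
noncomputable section

/-! ### The Lax sequence of a curve on the sphere -/

/-- The sequence `V₀ = -T`, `V_{m+1} = -T × V_m' + e_m T`, where `e_m` is half the sum of the
products `V_i · V_j` with `i + j = m + 1` and `i, j ≥ 1`. -/
def lax (T : ℝ → E3) : ℕ → ℝ → E3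
  | 0 => fun s => -T s
  | m + 1 => fun s => -cross (T s) (deriv (lax T m) s) +
      ((1 / 2 : ℝ) * ∑ i : Fin m, inner ℝ (lax T (i + 1) s) (lax T (m - i) s)) • T s

/-- The tangential component of `V_{m+1}`. -/
def laxEnergy (T : ℝ → E3) (m : ℕ) (s : ℝ) : ℝ :=
  (1 / 2) * ∑ i ∈ Finset.range m, inner ℝ (lax T (i + 1) s) (lax T (m - i) s)

theorem lax_zero (T : ℝ → E3) (s : ℝ) : lax T 0 s = -T s := by rw [lax]

theorem lax_succ (T : ℝ → E3) (m : ℕ) (s : ℝ) :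
    lax T (m + 1) s = -cross (T s) (deriv (lax T m) s) + laxEnergy T m s • T s := by
  rw [lax, laxEnergy, Finset.sum_range]

section Lax

variable {T : ℝ → E3}

theorem laxEnergy_zero (s : ℝ) : laxEnergy T 0 s = 0 := by simp [laxEnergy]

theorem inner_lax_succ (hT : ∀ s, inner ℝ (T s) (T s) = (1 : ℝ)) (m : ℕ) (s : ℝ) :
    inner ℝ (T s) (lax T (m + 1) s) = laxEnergy T m s := by
  rw [lax_succ, inner_add_right, inner_neg_right, inner_cross_left_self, inner_smul_right, hT]
  ring

theorem contDiff_lax (sT : ContDiff ℝ ∞ T) (m : ℕ) : ContDiff ℝ ∞ (lax T m) := by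
  induction m using Nat.strong_induction_on with
  | _ m ih =>
    cases m with
    | zero =>
      rw [show lax T 0 = fun s => -T s from funext (lax_zero T)]
      exact sT.neg
    | succ m =>
      rw [funext (lax_succ T m)]
      have h1 : ContDiff ℝ ∞ (fun s => cross (T s) (deriv (lax T m) s)) :=
        cross.isBoundedBilinearMap.contDiff.comp (sT.prodMk (contDiff_deriv (ih m (by omega))))
      have h2 : ContDiff ℝ ∞ (laxEnergy T m) := by
        refine contDiff_const.mul (ContDiff.sum fun i hi => ?_)
        rw [Finset.mem_range] at hi
        exact (ih (i + 1) (by omega)).inner ℝ (ih (m - i) (by omega))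
      exact h1.neg.add (h2.smul sT)

/-- The Lax equation. -/
theorem hasDerivAt_lax (sT : ContDiff ℝ ∞ T) (hT : ∀ s, inner ℝ (T s) (T s) = (1 : ℝ)) (m : ℕ)
    (s : ℝ) : HasDerivAt (lax T m) (cross (T s) (lax T (m + 1) s)) s := by
  induction m using Nat.strong_induction_on generalizing s with
  | _ m ih =>
    have hd := hasDerivAt_of_contDiff (contDiff_lax sT m) s
    have hT' := hasDerivAt_of_contDiff sT s
    have horth : inner ℝ (T s) (deriv T s) = (0 : ℝ) := by
      have h1 := hT'.inner ℝ hT'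
      rw [funext hT, real_inner_comm (T s) (deriv T s)] at h1
      linarith [h1.unique (hasDerivAt_const s (1 : ℝ))]
    have key : cross (T s) (lax T (m + 1) s)
        = deriv (lax T m) s - (inner ℝ (T s) (deriv (lax T m) s) : ℝ) • T s := by
      rw [lax_succ, map_add, map_neg, cross_cross_right, hT, map_smul, cross_self_eq_zero]
      simp
    -- Crossing the recursion with T recovers only the part of V_m' orthogonal to T, so the Lax
    -- equation amounts to V_m' having no tangential part.
    suffices h0 : inner ℝ (T s) (deriv (lax T m) s) = (0 : ℝ) by
      rw [key, h0, zero_smul, sub_zero]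
      exact hd
    cases m with
    | zero =>
      rw [show lax T 0 = fun s => -T s from funext (lax_zero T), hT'.fun_neg.deriv,
        inner_neg_right, horth, neg_zero]
    | succ m =>
      have hT0 : deriv T s = -cross (T s) (lax T 1 s) := by
        have h1 := ih 0 (by omega) s
        rw [show lax T 0 = fun s => -T s from funext (lax_zero T)] at h1
        rw [← h1.unique hT'.fun_neg |>.symm, neg_neg]
      -- By the Lax equation for smaller indices, the derivative of the i-th summand of 2 e_m is a
      -- (i + 1) - a i, so the sum telescopes. Antisymmetry of the triple product gives a m = -a 0,
      -- hence e_m' = -a 0 = T'·V_{m+1}, which is the required orthogonality because e_m =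
      -- T·V_{m+1}.
      set a : ℕ → ℝ := fun j => inner ℝ (cross (T s) (lax T (j + 1) s)) (lax T (m + 1 - j) s)
        with ha
      have hE : HasDerivAt (laxEnergy T m) ((1 / 2) * (a m - a 0)) s := by
        rw [← Finset.sum_range_sub a m]
        refine HasDerivAt.const_mul _ (HasDerivAt.fun_sum fun i hi => ?_)
        rw [Finset.mem_range] at hi
        refine ((ih (i + 1) (by omega) s).inner ℝ (ih (m - i) (by omega) s)).congr_deriv ?_
        simp only [ha]
        rw [show m + 1 - (i + 1) = m - i by omega, show m + 1 - i = m - i + 1 by omega,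
          inner_cross_swap (T s) (lax T (i + 1) s)]
        ring
      have ham : a m = -a 0 := by
        simp only [ha]
        rw [show m + 1 - m = 1 by omega, inner_cross_swap, real_inner_comm]
        rfl
      have h1 := hT'.inner ℝ hd
      rw [show (fun t => inner ℝ (T t) (lax T (m + 1) t)) = laxEnergy T m from
        funext (inner_lax_succ hT m)] at h1
      have h2 := h1.unique hE
      have h3 : a 0 = -inner ℝ (deriv T s) (lax T (m + 1) s) := by
        rw [hT0, inner_neg_left, neg_neg]
        rfl
      rw [ham, h3] at h2
      linarith

theorem hasDerivAt_inner_lax (sT : ContDiff ℝ ∞ T) (hT : ∀ s, inner ℝ (T s) (T s) = (1 : ℝ))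
    (i j : ℕ) (s : ℝ) : HasDerivAt (fun s => inner ℝ (lax T i s) (lax T j s))
      (inner ℝ (cross (T s) (lax T (i + 1) s)) (lax T j s)
        - inner ℝ (cross (T s) (lax T i s)) (lax T (j + 1) s)) s := by
  refine ((hasDerivAt_lax sT hT i s).inner ℝ (hasDerivAt_lax sT hT j s)).congr_deriv ?_
  rw [inner_cross_swap (T s) (lax T i s)]
  ring

/-- The formal power series with the coefficients `V_m` is a unit vector. -/
theorem sum_inner_lax (hT : ∀ s, inner ℝ (T s) (T s) = (1 : ℝ)) (m : ℕ) (s : ℝ) :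
    ∑ p ∈ Finset.HasAntidiagonal.antidiagonal m, inner ℝ (lax T p.1 s) (lax T p.2 s)
      = if m = 0 then (1 : ℝ) else 0 := by
  cases m with
  | zero => simp only [Finset.Nat.antidiagonal_zero, Finset.sum_singleton, lax_zero, inner_neg_neg, hT,
      if_true]
  | succ m =>
    rw [Finset.Nat.sum_antidiagonal_eq_sum_range_succ_mk, Finset.sum_range_succ,
      Finset.sum_range_succ']
    -- The inner terms sum to 2 e_m, and the two end terms, with V_0 = -T, contribute -e_m each.
    have h1 : ∑ i ∈ Finset.range m, inner ℝ (lax T (i + 1) s) (lax T (m + 1 - (i + 1)) s)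
        = 2 * laxEnergy T m s := by
      simp only [laxEnergy, Nat.add_sub_add_right]
      ring
    have h2 := inner_lax_succ hT m s
    simp only [h1, Nat.sub_zero, Nat.sub_self, lax_zero, inner_neg_left, inner_neg_right]
    rw [h2, real_inner_comm, h2, if_neg (Nat.succ_ne_zero m)]
    ring

end Lax

/-! ### Decay of the Lax sequence and vanishing of its pairings -/

section LaxFamily

variable {A : Type} {K : A → ℝ → ℝ} {T : A → ℝ → E3}

/-- Only V_0 fails to decay. Each later term is built from T, the derivative of its predecessor (T'
when that is V_0), and an e_m quadratic in V_1, …, V_m. -/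
theorem hasDeg_lax_succ (hK : IsWeight K) (h0 : HasDeg K 0 T)
    (h1 : HasDeg K 1 (fun a => deriv (T a))) (m : ℕ) :
    HasDeg K 1 (fun a => lax (T a) (m + 1)) := by
  induction m using Nat.strong_induction_on with
  | _ m ih =>
    have hd : HasDeg K 1 (fun a => deriv (lax (T a) m)) := by
      cases m with
      | zero =>
        rw [show (fun a => deriv (lax (T a) 0)) = fun a s => -deriv (T a) s by
          funext a s
          rw [show lax (T a) 0 = fun s => -T a s from funext (lax_zero (T a))]
          exact (hasDerivAt_of_contDiff (h0.smooth a) s).fun_neg.deriv]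
        exact h1.neg
      | succ m => exact (ih m (by omega)).deriv
    have he : HasDeg K 1 (fun a => laxEnergy (T a) m) := by
      refine HasDeg.const_smul (1 / 2) (HasDeg.sum hK.pos fun i hi => ?_)
      rw [Finset.mem_range] at hi
      have h2 := ih (m - i - 1) (by omega)
      rw [show m - i - 1 + 1 = m - i by omega] at h2
      exact ((ih i hi).inner hK.pos h2).of_le hK (by norm_num)
    rw [show (fun a => lax (T a) (m + 1)) = fun a s => -cross (T a s) (deriv (lax (T a) m) s)
      + laxEnergy (T a) m s • T a s from funext fun a => funext (lax_succ (T a) m)]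
    exact ((h0.cross hK.pos hd).of_le hK (by norm_num)).neg.add hK.pos
      ((he.smul hK.pos h0).of_le hK (by norm_num))

theorem hasDeg_lax (hK : IsWeight K) (h0 : HasDeg K 0 T)
    (h1 : HasDeg K 1 (fun a => deriv (T a))) (m : ℕ) : HasDeg K 0 (fun a => lax (T a) m) := by
  cases m with
  | zero =>
    rw [show (fun a => lax (T a) 0) = fun a s => -T a s from
      funext fun a => funext (lax_zero (T a))]
    exact h0.neg
  | succ m => exact (hasDeg_lax_succ hK h0 h1 m).of_le hK (by norm_num)

/-- The involution property of the Lax sequence. -/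
theorem integral_cross_lax (hK : IsWeight K) (h0 : HasDeg K 0 T)
    (h1 : HasDeg K 1 (fun a => deriv (T a))) (a : A)
    (hT : ∀ s, inner ℝ (T a s) (T a s) = (1 : ℝ)) (i j : ℕ) :
    ∫ s, (inner ℝ (cross (T a s) (lax (T a) i s)) (lax (T a) (j + 1) s) : ℝ) = 0 := by
  induction i generalizing j with
  | zero =>
    have h : ∀ s, (inner ℝ (cross (T a s) (lax (T a) 0 s)) (lax (T a) (j + 1) s) : ℝ) = 0 := by
      intro s
      rw [lax_zero, map_neg, cross_self_eq_zero, neg_zero, inner_zero_left]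
    simp only [h, integral_zero]
  | succ i ih =>
    have hD : ∀ i j, HasDeg K 1 (fun a s => (inner ℝ (cross (T a s) (lax (T a) i s))
        (lax (T a) (j + 1) s) : ℝ)) := fun i j =>
      (((h0.cross hK.pos (hasDeg_lax hK h0 h1 i)).inner hK.pos
        (hasDeg_lax_succ hK h0 h1 j))).of_le hK (by norm_num)
    -- Integrating the derivative of V_i·V_{j+1} equates the integral for (i + 1, j) with that for
    -- (i, j + 1), which is covered by the induction hypothesis because j is arbitrary there.
    have hI := ((hasDeg_lax hK h0 h1 i).inner hK.pos
      (hasDeg_lax_succ hK h0 h1 j)).integral_deriv_eq_zero hK (by norm_num) a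
      (hasDerivAt_inner_lax (h0.smooth a) hT i (j + 1))
    rw [integral_sub ((hD (i + 1) j).integrable hK le_rfl a)
      ((hD i (j + 1)).integrable hK le_rfl a), ih (j + 1), sub_zero] at hI
    exact hI

end LaxFamily

end
end Filament
namespace Filament
noncomputable section

/-! ### Bounds for balanced asymptotically linear curves -/

theorem exists_abs_le_add {f g : ℝ → ℝ} (hf : Continuous f) (hg : ∀ s, 0 ≤ g s)
    (htop : ∀ᶠ s in atTop, |f s| ≤ g s) (hbot : ∀ᶠ s in atBot, |f s| ≤ g s) :
    ∃ M, 0 ≤ M ∧ ∀ s, |f s| ≤ g s + M := by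
  obtain ⟨b, hb⟩ := eventually_atTop.1 htop
  obtain ⟨a, ha⟩ := eventually_atBot.1 hbot
  obtain ⟨M, hM⟩ := (isCompact_Icc (a := a) (b := b)).exists_bound_of_continuousOn
    hf.continuousOn
  refine ⟨|M|, abs_nonneg M, fun s => ?_⟩
  rcases le_total s a with h | h
  · linarith [ha s h, abs_nonneg M]
  · rcases le_total b s with h' | h'
    · linarith [hb s h', abs_nonneg M]
    · have h1 := hM s ⟨h, h'⟩
      rw [Real.norm_eq_abs] at h1
      linarith [hg s, le_abs_self M]

theorem abs_polynomial_eval_le (P : Polynomial ℝ) :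
    ∃ (C : ℝ) (k : ℕ), 0 ≤ C ∧ ∀ s, |P.eval s| ≤ C * (1 + |s|) ^ k := by
  refine ⟨∑ i ∈ Finset.range (P.natDegree + 1), |P.coeff i|, P.natDegree,
    Finset.sum_nonneg fun i _ => abs_nonneg _, fun s => ?_⟩
  rw [Polynomial.eval_eq_sum_range, Finset.sum_mul]
  refine (Finset.abs_sum_le_sum_abs _ _).trans (Finset.sum_le_sum fun i hi => ?_)
  rw [abs_mul, abs_pow]
  gcongr
  have h0 := abs_nonneg s
  calc |s| ^ i ≤ (1 + |s|) ^ i := by gcongr; linarith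
    _ ≤ (1 + |s|) ^ P.natDegree :=
      pow_le_pow_right₀ (by linarith) (by rw [Finset.mem_range] at hi; omega)

theorem PolyLike.exists_bound {f : ℝ → ℝ} (hf : PolyLike f) (hc : Continuous f) :
    ∃ (C : ℝ) (k : ℕ), ∀ s, |f s| ≤ C * (1 + |s|) ^ k := by
  obtain ⟨P, hP, htop, hbot⟩ := hf
  -- At a root of P the quotient is 0 by convention and says nothing about f; the finitely many
  -- roots are avoided near both ends.
  have hroot : ∀ᶠ s in cofinite, P.eval s ≠ 0 :=
    (Polynomial.finite_setOfPred_isRoot hP).subset fun s hs => by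
      simpa [Polynomial.IsRoot] using hs
  have key : ∀ l : Filter ℝ, l ≤ cofinite → Tendsto (fun s => f s / P.eval s) l (𝓝 0) →
      ∀ᶠ s in l, |f s| ≤ |P.eval s| := by
    intro l hl h
    filter_upwards [hl hroot, (h.abs.eventually_le_const (by simp : |(0 : ℝ)| < 1))] with s h1 h2
    rwa [abs_div, div_le_one (abs_pos.2 h1)] at h2
  obtain ⟨M, hM0, hM⟩ := exists_abs_le_add hc (fun s => abs_nonneg (P.eval s))
    (key _ atTop_le_cofinite htop) (key _ atBot_le_cofinite hbot)
  obtain ⟨C, k, hC, h⟩ := abs_polynomial_eval_le P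
  refine ⟨C + M, k, fun s => (hM s).trans ?_⟩
  have h1 : 1 ≤ (1 + |s|) ^ k := one_le_pow₀ (by linarith [abs_nonneg s])
  have h2 : M ≤ M * (1 + |s|) ^ k := le_mul_of_one_le_right hM0 h1
  linarith [h s]

/-- Families of regular curves whose curvature is a weight and whose torsion has degree zero. -/
structure IsControlled {A : Type} (c : A → ℝ → E3) : Prop where
  regular : ∀ a, IsRegular (c a)
  weight : IsWeight fun a => curvature (c a)
  hasDeg_torsion : HasDeg (fun a => curvature (c a)) 0 (fun a => torsion (c a))

/-- Continuity on compact intervals turns the asymptotic conditions into bounds on the whole line. A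
single curve is treated as a family over `Unit`, so that curves and paths share one calculus. -/
theorem IsBAL.isControlled {γ₀ γ : ℝ → E3} (h : IsBAL γ₀ γ) :
    IsControlled (fun _ : Unit => γ) where
  regular _ := h.isRegular
  weight :=
    { pos := fun _ => h.isRegular.curvature_pos
      decay := fun k => by
        have h1 := h.curvature_decay (Polynomial.X ^ k)
        simp only [Polynomial.eval_pow, Polynomial.eval_X] at h1
        have hc : Continuous fun s => curvature γ s * s ^ k :=
          h.isRegular.contDiff_curvature.continuous.mul (continuous_pow k)
        obtain ⟨M, _, hM⟩ := exists_abs_le_add hc (fun _ => zero_le_one)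
          (h1.1.abs.eventually_le_const (by simp : |(0 : ℝ)| < 1))
          (h1.2.abs.eventually_le_const (by simp : |(0 : ℝ)| < 1))
        refine ⟨1 + M, fun _ s => ?_⟩
        have h2 := hM s
        rwa [abs_mul, abs_pow, abs_of_pos (h.isRegular.curvature_pos s), mul_comm] at h2
      deg := by
        refine HasDeg.of_iteratedDeriv (fun _ => h.isRegular.curvature_pos)
          (fun _ => h.isRegular.contDiff_curvature) fun j => ?_
        have hc : Continuous fun s => (curvature γ s)⁻¹ * iteratedDeriv j (curvature γ) s :=
          (h.isRegular.contDiff_curvature.continuous.inv₀ h.curvature_ne_zero).mul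
            (h.isRegular.contDiff_curvature.continuous_iteratedDeriv j (by exact_mod_cast le_top))
        obtain ⟨C, k, hC⟩ := (h.curvature_poly j).exists_bound hc
        refine ⟨C, k, fun _ s => ?_⟩
        have h1 := hC s
        have hp := h.isRegular.curvature_pos s
        rw [abs_mul, abs_inv, abs_of_pos hp, inv_mul_le_iff₀ hp] at h1
        rw [zpow_one]
        linarith }
  hasDeg_torsion := by
    refine HasDeg.of_iteratedDeriv (fun _ => h.isRegular.curvature_pos)
      (fun _ => h.isRegular.contDiff_torsion) fun j => ?_
    obtain ⟨C, k, hC⟩ := (h.torsion_poly j).exists_bound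
      (h.isRegular.contDiff_torsion.continuous_iteratedDeriv j (by exact_mod_cast le_top))
    exact ⟨C, k, fun _ s => by simpa using hC s⟩

theorem IsFrame.norm_le {t n b : E3} (h : IsFrame t n b) : ‖t‖ ≤ 1 ∧ ‖n‖ ≤ 1 ∧ ‖b‖ ≤ 1 := by
  have key : ∀ x : E3, inner ℝ x x = (1 : ℝ) → ‖x‖ ≤ 1 := fun x hx => by
    rw [real_inner_self_eq_norm_sq] at hx
    nlinarith [norm_nonneg x]
  exact ⟨key t h.tt, key n h.nn, key b h.bb⟩

namespace IsControlled

variable {A : Type} {c : A → ℝ → E3} (h : IsControlled c)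

include h

/-- The Frenet equations couple the three vectors, so the induction on the order runs for all of
them together: bounds of order l on the frame, with κ and τ of degree 0, bound its derivatives to
order l. -/
theorem orderBound_frame (l : ℕ) :
    OrderBound (fun a => curvature (c a)) 0 l (fun a => tangent (c a)) ∧
    OrderBound (fun a => curvature (c a)) 0 l (fun a => normal (c a)) ∧
    OrderBound (fun a => curvature (c a)) 0 l (fun a => binormal (c a)) := by
  have hn := fun a s => ((h.regular a).isFrame s).norm_le
  have b1 : PolyBound (fun a => curvature (c a)) 0 (fun a => tangent (c a)) :=
    ⟨1, 0, zero_le_one, fun a s => by simpa using (hn a s).1⟩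
  have b2 : PolyBound (fun a => curvature (c a)) 0 (fun a => normal (c a)) :=
    ⟨1, 0, zero_le_one, fun a s => by simpa using (hn a s).2.1⟩
  have b3 : PolyBound (fun a => curvature (c a)) 0 (fun a => binormal (c a)) :=
    ⟨1, 0, zero_le_one, fun a s => by simpa using (hn a s).2.2⟩
  induction l with
  | zero => exact ⟨b1, b2, b3⟩
  | succ l ih =>
    obtain ⟨i1, i2, i3⟩ := ih
    have s1 := fun a => (h.regular a).contDiff_tangent
    have s2 := fun a => (h.regular a).contDiff_normal
    have s3 := fun a => (h.regular a).contDiff_binormal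
    have k0 := h.weight.deg.of_le h.weight (zero_le_one)
    refine ⟨⟨b1, ?_⟩, ⟨b2, ?_⟩, ⟨b3, ?_⟩⟩
    · rw [show (fun a => deriv (tangent (c a))) = fun a s => curvature (c a) s • normal (c a) s
        from funext fun a => funext fun s => ((h.regular a).hasDerivAt_tangent s).deriv]
      exact OrderBound.bilin h.weight.pos (ContinuousLinearMap.lsmul ℝ ℝ) k0.smooth s2
        (k0.bound l) i2
    · rw [show (fun a => deriv (normal (c a))) = fun a s =>
          (-1 : ℝ) • (curvature (c a) s • tangent (c a) s) + torsion (c a) s • binormal (c a) s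
        from funext fun a => funext fun s => by
          rw [((h.regular a).hasDerivAt_normal s).deriv]; module]
      refine OrderBound.add h.weight.pos (fun a => ((k0.smooth a).smul (s1 a)).const_smul (-1 : ℝ))
        (fun a => (h.hasDeg_torsion.smooth a).smul (s3 a)) (OrderBound.const_smul (-1)
          (fun a => (k0.smooth a).smul (s1 a)) ?_) ?_
      · exact OrderBound.bilin h.weight.pos (ContinuousLinearMap.lsmul ℝ ℝ) k0.smooth s1
          (k0.bound l) i1
      · exact OrderBound.bilin h.weight.pos (ContinuousLinearMap.lsmul ℝ ℝ) h.hasDeg_torsion.smooth s3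
          (h.hasDeg_torsion.bound l) i3
    · rw [show (fun a => deriv (binormal (c a))) = fun a s =>
          (-1 : ℝ) • (torsion (c a) s • normal (c a) s)
        from funext fun a => funext fun s => by
          rw [((h.regular a).hasDerivAt_binormal s).deriv]; module]
      exact OrderBound.const_smul (-1) (fun a => (h.hasDeg_torsion.smooth a).smul (s2 a))
        (OrderBound.bilin h.weight.pos (ContinuousLinearMap.lsmul ℝ ℝ) h.hasDeg_torsion.smooth s2
          (h.hasDeg_torsion.bound l) i2)

theorem hasDeg_tangent : HasDeg (fun a => curvature (c a)) 0 (fun a => tangent (c a)) :=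
  ⟨fun a => (h.regular a).contDiff_tangent, fun l => (h.orderBound_frame l).1⟩

theorem hasDeg_normal : HasDeg (fun a => curvature (c a)) 0 (fun a => normal (c a)) :=
  ⟨fun a => (h.regular a).contDiff_normal, fun l => (h.orderBound_frame l).2.1⟩

theorem hasDeg_binormal : HasDeg (fun a => curvature (c a)) 0 (fun a => binormal (c a)) :=
  ⟨fun a => (h.regular a).contDiff_binormal, fun l => (h.orderBound_frame l).2.2⟩

theorem hasDeg_deriv_tangent :
    HasDeg (fun a => curvature (c a)) 1 (fun a => deriv (tangent (c a))) := by
  rw [show (fun a => deriv (tangent (c a))) =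
      fun a s => curvature (c a) s • normal (c a) s
    from funext fun a => funext fun s => ((h.regular a).hasDerivAt_tangent s).deriv]
  exact h.weight.deg.smul h.weight.pos h.hasDeg_normal

end IsControlled

/-! ### Scalar fields given by expressions -/

variable {γ₀ : ℝ → E3}

/-- The formal degree of an expression is an analytic degree with weight κ. In particular ∂_s⁻¹ and
∫, being restricted to degree 2, are only ever applied to integrable functions. -/
theorem hasDeg_of_mem_alge {n : ℤ} {f : ScalarField γ₀} (hf : f ∈ alge γ₀ n) (γ : BAL γ₀) :
    HasDeg (fun _ : Unit => curvature γ.1) n (fun _ => f γ) := by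
  have hc := γ.2.isControlled
  have hK := hc.weight
  have key : ∀ {n : ℤ} {F : Unit → ScalarField γ₀}, AlgDep (P := Unit) (ι := Empty)
      (fun i => i.elim) (fun i => i.elim) n F →
      HasDeg (fun _ : Unit => curvature γ.1) n (fun p => F p γ) := by
    intro n F hF
    induction hF with
    | var i => exact i.elim
    | kappa => exact hK.deg
    | kappaInv => exact HasDeg.inv hK
    | tau => exact hc.hasDeg_torsion
    | param => exact HasDeg.id
    | ell => exact HasDeg.const (C := ‖ell γ‖) fun _ => le_rfl
    | one => exact HasDeg.const (c := fun _ => (1 : ℝ)) (C := ‖(1 : ℝ)‖) fun _ => le_rfl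
    | zero n => exact HasDeg.zero
    | add _ _ h1 h2 => exact h1.add hK.pos h2
    | smul c _ h1 => exact h1.const_smul c
    | mul _ _ h1 h2 => exact h1.mul hK.pos h2
    | lower _ h1 => exact h1.lower hK
    | deriv _ h1 => exact h1.deriv
    | antideriv _ h1 => exact h1.antideriv hK (by norm_num)
    | @integ f _ h1 => exact HasDeg.const (C := ‖integ (f ()) γ‖) fun _ => le_rfl
  exact key hf

theorem AlgDep.of_mem_alge {P ι : Type} {v : ι → P → ScalarField γ₀} {d : ι → ℤ} {n : ℤ}
    {f : ScalarField γ₀} (hf : f ∈ alge γ₀ n) : AlgDep v d n (fun _ => f) := by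
  have key : ∀ {n : ℤ} {F : Unit → ScalarField γ₀}, AlgDep (P := Unit) (ι := Empty)
      (fun i => i.elim) (fun i => i.elim) n F → AlgDep v d n (fun _ => F ()) := by
    intro n F hF
    induction hF with
    | var i => exact i.elim
    | kappa => exact AlgDep.kappa
    | kappaInv => exact AlgDep.kappaInv
    | tau => exact AlgDep.tau
    | param => exact AlgDep.param
    | ell => exact AlgDep.ell
    | one => exact AlgDep.one
    | zero n => exact AlgDep.zero n
    | add _ _ h1 h2 => exact AlgDep.add h1 h2
    | smul c _ h1 => exact AlgDep.smul c h1
    | mul _ _ h1 h2 => exact AlgDep.mul h1 h2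
    | lower _ h1 => exact AlgDep.lower h1
    | deriv _ h1 => exact AlgDep.deriv h1
    | antideriv _ h1 => exact AlgDep.antideriv h1
    | integ _ h1 => exact AlgDep.integ h1
  exact key hf

/-! ### The symmetries and the Lax sequence -/

namespace VField

variable (X : VField γ₀) (γ : BAL γ₀)

theorem hasDeg_nc : HasDeg (fun _ : Unit => curvature γ.1) 1 (fun _ => X.nc γ) :=
  hasDeg_of_mem_alge X.2.1 γ

theorem hasDeg_bc : HasDeg (fun _ : Unit => curvature γ.1) 1 (fun _ => X.bc γ) :=
  hasDeg_of_mem_alge X.2.2 γ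

theorem hasDeg_kappa_nc :
    HasDeg (fun _ : Unit => curvature γ.1) 2 (fun _ => (kappa * X.nc : ScalarField γ₀) γ) :=
  hasDeg_of_mem_alge (mul_mem kappa_mem X.2.1 (by norm_num)) γ

/-- The lift of a vector field to a field along a curve. -/
def lift (s : ℝ) : E3 :=
  DsInv (Filament.kappa * X.nc) γ s • tangent γ.1 s + X.nc γ s • normal γ.1 s
    + X.bc γ s • binormal γ.1 s

theorem inner_cross_lift (Y : VField γ₀) (s : ℝ) :
    inner ℝ (cross (tangent γ.1 s) (X.lift γ s)) (Y.lift γ s)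
      = (X.nc γ s * Y.bc γ s - X.bc γ s * Y.nc γ s : ℝ) := by
  have hF := γ.2.isRegular.isFrame s
  simp only [lift, map_add, map_smul, cross_self_eq_zero, hF.cross_tn, hF.cross_tb,
    inner_add_left, inner_add_right, inner_smul_left, inner_smul_right, hF.bt, hF.bn, hF.bb,
    hF.nt, hF.nn, hF.nb, inner_neg_left, inner_zero_left, smul_zero]
  simp
  ring

end VField

/-- The recursion operator and the Lax recursion agree: both apply -T × to the derivative, -T ×
being J on normal fields, and both then restore a tangential part. The nonlocal ∂_s⁻¹(κ g) and the
algebraic e_m coincide as primitives of the same function with the same limits. -/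
theorem lax_eq_lift (n : ℕ) (γ : BAL γ₀) :
    lax (tangent γ.1) (n + 1) = (Xsym n : VField γ₀).lift γ := by
  have hr := γ.2.isRegular
  have hc := γ.2.isControlled
  have hT := hr.arclength.inner_tangent
  induction n with
  | zero =>
    funext s
    have hF := hr.isFrame s
    have h0 : DsInv (kappa * (kappaB : VField γ₀).nc : ScalarField γ₀) γ s = 0 := by
      have : (kappa * (kappaB : VField γ₀).nc : ScalarField γ₀) γ = fun _ => 0 := by
        funext t
        exact mul_zero _
      simp [DsInv, this, antideriv]
    rw [lax_succ, laxEnergy_zero, show lax (tangent γ.1) 0 = fun s => -tangent γ.1 s from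
      funext (lax_zero _), (hr.hasDerivAt_tangent s).fun_neg.deriv, map_neg, map_smul, hF.cross_tn]
    change _ = DsInv (kappa * (kappaB : VField γ₀).nc : ScalarField γ₀) γ s • tangent γ.1 s
      + (0 : ℝ) • normal γ.1 s + curvature γ.1 s • binormal γ.1 s
    rw [h0]
    simp
  | succ n ih =>
    set X : VField γ₀ := Xsym n with hX
    have hX' : (Xsym (n + 1) : VField γ₀) = R X := Function.iterate_succ_apply' _ _ _
    rw [hX']
    -- Normal and binormal parts: the Frenet equations applied to the lift of X, followed by -T ×.
    have hd : ∀ s, lax (tangent γ.1) (n + 1 + 1) s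
        = laxEnergy (tangent γ.1) (n + 1) s • tangent γ.1 s
          + (R X).nc γ s • normal γ.1 s + (R X).bc γ s • binormal γ.1 s := by
      intro s
      have hF := hr.isFrame s
      have hD := hr.hasDerivAt_comb
        ((X.hasDeg_kappa_nc γ).hasDerivAt_antideriv hc.weight (by norm_num) () s)
        (hasDerivAt_of_contDiff ((X.hasDeg_nc γ).smooth ()) s)
        (hasDerivAt_of_contDiff ((X.hasDeg_bc γ).smooth ()) s)
      have h1 : (R X).nc γ s = deriv (X.bc γ) s + torsion γ.1 s * X.nc γ s := rfl
      have h2 : (R X).bc γ s = -(deriv (X.nc γ) s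
        + curvature γ.1 s * antideriv ((kappa * X.nc : ScalarField γ₀) γ) s - torsion γ.1 s * X.bc γ s) := rfl
      rw [lax_succ, ih]
      have h3 : deriv (X.lift γ) s = _ := hD.deriv
      rw [h3, h1, h2]
      simp only [map_add, map_smul, cross_self_eq_zero, hF.cross_tn, hF.cross_tb]
      module
    -- Tangential part: (T·V_{n+2})' = κ N·V_{n+2}, since V_{n+2}' is orthogonal to T; e_{n+1} has
    -- positive degree, so it vanishes at both ends.
    have hE : antideriv ((kappa * (R X).nc : ScalarField γ₀) γ) = laxEnergy (tangent γ.1) (n + 1) := by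
      have hdeg := hc.hasDeg_tangent.inner hc.weight.pos
        (hasDeg_lax_succ hc.weight hc.hasDeg_tangent hc.hasDeg_deriv_tangent (n + 1))
      rw [show (fun (_ : Unit) s => (inner ℝ (tangent γ.1 s) (lax (tangent γ.1) (n + 1 + 1) s) : ℝ))
        = fun _ => laxEnergy (tangent γ.1) (n + 1) from
          funext fun _ => funext (inner_lax_succ hT (n + 1))] at hdeg
      refine antideriv_eq_of_hasDerivAt
        (((R X).hasDeg_kappa_nc γ).integrable hc.weight (by norm_num) ()) (fun s => ?_)
        (hdeg.tendsto_zero_atTop hc.weight (by norm_num) ())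
        (hdeg.tendsto_zero_atBot hc.weight (by norm_num) ())
      have hF := hr.isFrame s
      have h1 := (hr.hasDerivAt_tangent s).inner ℝ
        (hasDerivAt_lax hr.contDiff_tangent hT (n + 1 + 1) s)
      rw [show (fun t => inner ℝ (tangent γ.1 t) (lax (tangent γ.1) (n + 1 + 1) t))
        = laxEnergy (tangent γ.1) (n + 1) from funext (inner_lax_succ hT (n + 1))] at h1
      refine h1.congr_deriv ?_
      rw [inner_cross_left_self, hd s, inner_smul_left, inner_add_right, inner_add_right,
        inner_smul_right, inner_smul_right, inner_smul_right, hF.nt, hF.nn, hF.nb]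
      change _ = curvature γ.1 s * (R X).nc γ s
      simp
    funext s
    rw [hd s, ← hE]
    rfl

end
end Filament
namespace Filament
noncomputable section

/-! ### The generating series of the Lax sequence -/

/-- The triple product. -/
def triple {S : Type*} [CommRing S] (v w u : Fin 3 → S) : S :=
  v 0 * (w 1 * u 2 - w 2 * u 1) + v 1 * (w 2 * u 0 - w 0 * u 2) + v 2 * (w 0 * u 1 - w 1 * u 0)

/-- The derivative of the triple product of a solution `v` of the Lax equation `x v' = t × v`, of
a solution `w` of the linearized equation and of the derivative `u` of `v` by the parameter `x`. -/
theorem triple_lax {S : Type*} [CommRing S] {x : S} {t dt v v' w w' u u' : Fin 3 → S}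
    (h10 : x * v' 0 = t 1 * v 2 - t 2 * v 1) (h11 : x * v' 1 = t 2 * v 0 - t 0 * v 2)
    (h12 : x * v' 2 = t 0 * v 1 - t 1 * v 0)
    (h20 : x * w' 0 = dt 1 * v 2 - dt 2 * v 1 + (t 1 * w 2 - t 2 * w 1))
    (h21 : x * w' 1 = dt 2 * v 0 - dt 0 * v 2 + (t 2 * w 0 - t 0 * w 2))
    (h22 : x * w' 2 = dt 0 * v 1 - dt 1 * v 0 + (t 0 * w 1 - t 1 * w 0))
    (h30 : v' 0 + x * u' 0 = t 1 * u 2 - t 2 * u 1)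
    (h31 : v' 1 + x * u' 1 = t 2 * u 0 - t 0 * u 2)
    (h32 : v' 2 + x * u' 2 = t 0 * u 1 - t 1 * u 0)
    (hvv : v 0 * v 0 + v 1 * v 1 + v 2 * v 2 = 1)
    (hvw : v 0 * w 0 + v 1 * w 1 + v 2 * w 2 = 0)
    (hvu : v 0 * u 0 + v 1 * u 1 + v 2 * u 2 = 0) :
    x * (x * (triple v' w u + triple v w' u + triple v w u'))
      = x * (dt 0 * u 0 + dt 1 * u 1 + dt 2 * u 2) + (t 0 * w 0 + t 1 * w 1 + t 2 * w 2) := by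
  simp only [triple]
  -- The three equations are paired with w × u, u × v and v × w. The terms where t × acts on v, w
  -- and u in turn cancel by rotation invariance of the determinant. What remains is x (u × v)·(dt ×
  -- v) - (v × w)·(t × v), the last term removing the extra v' in the x-derivative; the Lagrange
  -- identity and the constraints on v·v, v·w, v·u finish.
  linear_combination x * ((w 1 * u 2 - w 2 * u 1) * h10 + (w 2 * u 0 - w 0 * u 2) * h11
      + (w 0 * u 1 - w 1 * u 0) * h12)
    + x * ((u 1 * v 2 - u 2 * v 1) * h20 + (u 2 * v 0 - u 0 * v 2) * h21
      + (u 0 * v 1 - u 1 * v 0) * h22)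
    + x * ((v 1 * w 2 - v 2 * w 1) * h30 + (v 2 * w 0 - v 0 * w 2) * h31
      + (v 0 * w 1 - v 1 * w 0) * h32)
    - ((v 1 * w 2 - v 2 * w 1) * h10 + (v 2 * w 0 - v 0 * w 2) * h11
      + (v 0 * w 1 - v 1 * w 0) * h12)
    + x * (dt 0 * u 0 + dt 1 * u 1 + dt 2 * u 2) * hvv
    - x * (dt 0 * v 0 + dt 1 * v 1 + dt 2 * v 2) * hvu
    + (t 0 * w 0 + t 1 * w 1 + t 2 * w 2) * hvv
    - (t 0 * v 0 + t 1 * v 1 + t 2 * v 2) * hvw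

/-- The formal power series with given coefficients in three-space. -/
def series (V : ℕ → E3) (i : Fin 3) : PowerSeries ℝ := PowerSeries.mk fun n => V n i

/-- The derivative of a formal power series by its variable. -/
def seriesDeriv (V : ℕ → E3) (i : Fin 3) : PowerSeries ℝ :=
  PowerSeries.derivative ℝ (series V i)

/-- The triple product of `v`, `w` and the derivative of `v` by the variable. -/
def tripleSeries (V W : ℕ → E3) : PowerSeries ℝ :=
  triple (series V) (series W) (seriesDeriv V)

theorem coeff_series (V : ℕ → E3) (i : Fin 3) (n : ℕ) :
    PowerSeries.coeff n (series V i) = V n i := PowerSeries.coeff_mk _ _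

theorem coeff_seriesDeriv (V : ℕ → E3) (i : Fin 3) (n : ℕ) :
    PowerSeries.coeff n (seriesDeriv V i) = V (n + 1) i * (n + 1) := by
  rw [seriesDeriv, PowerSeries.coeff_derivative, coeff_series]

theorem coeff_dot_series (V W : ℕ → E3) (n : ℕ) :
    PowerSeries.coeff n (series V 0 * series W 0 + series V 1 * series W 1
      + series V 2 * series W 2)
      = ∑ p ∈ Finset.HasAntidiagonal.antidiagonal n, inner ℝ (V p.1) (W p.2) := by
  simp only [map_add, PowerSeries.coeff_mul, coeff_series, ← Finset.sum_add_distrib,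
    inner_coords]

/-- The Lax equation for formal power series. -/
theorem X_mul_series {T : E3} {V V' : ℕ → E3} (h0 : cross T (V 0) = 0)
    (h : ∀ n, V' n = cross T (V (n + 1))) :
    PowerSeries.X * series V' 0
        = PowerSeries.C (T 1) * series V 2 - PowerSeries.C (T 2) * series V 1 ∧
    PowerSeries.X * series V' 1
        = PowerSeries.C (T 2) * series V 0 - PowerSeries.C (T 0) * series V 2 ∧
    PowerSeries.X * series V' 2
        = PowerSeries.C (T 0) * series V 1 - PowerSeries.C (T 1) * series V 0 := by
  refine ⟨?_, ?_, ?_⟩ <;> ext n <;> cases n with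
  | zero =>
    simp only [PowerSeries.coeff_zero_X_mul, map_sub, PowerSeries.coeff_C_mul, coeff_series,
      ← cross_zero_coord, ← cross_one_coord, ← cross_two_coord, h0]
    rfl
  | succ n =>
    simp only [PowerSeries.coeff_succ_X_mul, map_sub, PowerSeries.coeff_C_mul, coeff_series,
      h, cross_zero_coord, cross_one_coord, cross_two_coord]

/-- The linearized Lax equation for formal power series. -/
theorem X_mul_series_linearized {T dT : E3} {V W W' : ℕ → E3}
    (h0 : cross dT (V 0) + cross T (W 0) = 0)
    (h : ∀ n, W' n = cross dT (V (n + 1)) + cross T (W (n + 1))) :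
    PowerSeries.X * series W' 0
        = PowerSeries.C (dT 1) * series V 2 - PowerSeries.C (dT 2) * series V 1
          + (PowerSeries.C (T 1) * series W 2 - PowerSeries.C (T 2) * series W 1) ∧
    PowerSeries.X * series W' 1
        = PowerSeries.C (dT 2) * series V 0 - PowerSeries.C (dT 0) * series V 2
          + (PowerSeries.C (T 2) * series W 0 - PowerSeries.C (T 0) * series W 2) ∧
    PowerSeries.X * series W' 2
        = PowerSeries.C (dT 0) * series V 1 - PowerSeries.C (dT 1) * series V 0
          + (PowerSeries.C (T 0) * series W 1 - PowerSeries.C (T 1) * series W 0) := by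
  refine ⟨?_, ?_, ?_⟩ <;> ext n <;> cases n with
  | zero =>
    simp only [PowerSeries.coeff_zero_X_mul, map_sub, map_add, PowerSeries.coeff_C_mul,
      coeff_series, ← cross_zero_coord, ← cross_one_coord, ← cross_two_coord, ← PiLp.add_apply, h0]
    rfl
  | succ n =>
    simp only [PowerSeries.coeff_succ_X_mul, map_sub, map_add, PowerSeries.coeff_C_mul,
      coeff_series, h, PiLp.add_apply, cross_zero_coord, cross_one_coord, cross_two_coord]

theorem derivative_X_mul_eq {p q r : PowerSeries ℝ} {a b : ℝ}
    (h : PowerSeries.X * p = PowerSeries.C a * q - PowerSeries.C b * r) :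
    p + PowerSeries.X * PowerSeries.derivative ℝ p
      = PowerSeries.C a * PowerSeries.derivative ℝ q
        - PowerSeries.C b * PowerSeries.derivative ℝ r := by
  have h1 := congrArg (PowerSeries.derivative ℝ) h
  simp only [map_sub, Derivation.leibniz, PowerSeries.derivative_C, smul_eq_mul, mul_zero,
    add_zero, PowerSeries.derivative_X, mul_one] at h1
  rw [← h1, add_comm]

/-- The coefficient of x^{n+2} in `triple_lax`: the factor x² on the left accounts for the shift,
and x ∂_x multiplies V_{n+2} by n + 2. -/
theorem coeff_triple_lax {T dT : E3} {V V' W W' : ℕ → E3}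
    (hV0 : cross T (V 0) = 0) (hV : ∀ n, V' n = cross T (V (n + 1)))
    (hW0 : cross dT (V 0) + cross T (W 0) = 0)
    (hW : ∀ n, W' n = cross dT (V (n + 1)) + cross T (W (n + 1)))
    (hVV : ∀ n, ∑ p ∈ Finset.HasAntidiagonal.antidiagonal n, inner ℝ (V p.1) (V p.2)
      = if n = 0 then (1 : ℝ) else 0)
    (hVW : ∀ n, ∑ p ∈ Finset.HasAntidiagonal.antidiagonal n, inner ℝ (V p.1) (W p.2) = (0 : ℝ))
    (n : ℕ) :
    PowerSeries.coeff n (triple (series V') (series W) (seriesDeriv V)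
        + triple (series V) (series W') (seriesDeriv V)
        + triple (series V) (series W) (seriesDeriv V'))
      = ((n : ℝ) + 2) * inner ℝ dT (V (n + 2)) + inner ℝ T (W (n + 2)) := by
  obtain ⟨h10, h11, h12⟩ := X_mul_series hV0 hV
  obtain ⟨h20, h21, h22⟩ := X_mul_series_linearized hW0 hW
  have hvv : series V 0 * series V 0 + series V 1 * series V 1 + series V 2 * series V 2 = 1 := by
    ext n
    rw [coeff_dot_series, hVV, PowerSeries.coeff_one]
  have hvw : series V 0 * series W 0 + series V 1 * series W 1 + series V 2 * series W 2 = 0 := by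
    ext n
    rw [coeff_dot_series, hVW, map_zero]
  have hvu : series V 0 * seriesDeriv V 0 + series V 1 * seriesDeriv V 1
      + series V 2 * seriesDeriv V 2 = 0 := by
    have h1 := congrArg (PowerSeries.derivative ℝ) hvv
    simp only [map_add, Derivation.leibniz, smul_eq_mul, Derivation.map_one_eq_zero] at h1
    have h2 : (2 : ℝ) • (series V 0 * seriesDeriv V 0 + series V 1 * seriesDeriv V 1
      + series V 2 * seriesDeriv V 2) = 0 := by
      rw [two_smul]
      simp only [seriesDeriv]
      linear_combination h1
    exact (smul_eq_zero.1 h2).resolve_left two_ne_zero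
  have key := triple_lax (t := fun i => PowerSeries.C (T i)) (dt := fun i => PowerSeries.C (dT i))
    (u := seriesDeriv V) (u' := seriesDeriv V')
    h10 h11 h12 h20 h21 h22 (derivative_X_mul_eq h10) (derivative_X_mul_eq h11)
    (derivative_X_mul_eq h12) hvv hvw hvu
  have h3 := congrArg (PowerSeries.coeff (n + 2)) key
  rw [PowerSeries.coeff_succ_X_mul, PowerSeries.coeff_succ_X_mul,
    map_add (PowerSeries.coeff (n + 2)), PowerSeries.coeff_succ_X_mul] at h3
  rw [h3]
  simp only [map_add, PowerSeries.coeff_C_mul, coeff_series, coeff_seriesDeriv, inner_coords]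
  push_cast
  ring

/-- Coefficientwise derivatives of power series that depend on a parameter. -/
def HasCoeffDeriv (p : ℝ → PowerSeries ℝ) (p' : PowerSeries ℝ) (s : ℝ) : Prop :=
  ∀ n, HasDerivAt (fun t => PowerSeries.coeff n (p t)) (PowerSeries.coeff n p') s

namespace HasCoeffDeriv

variable {p q : ℝ → PowerSeries ℝ} {p' q' : PowerSeries ℝ} {s : ℝ}

theorem add (hp : HasCoeffDeriv p p' s) (hq : HasCoeffDeriv q q' s) :
    HasCoeffDeriv (fun t => p t + q t) (p' + q') s := fun n => by
  simpa only [map_add] using (hp n).fun_add (hq n)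

theorem sub (hp : HasCoeffDeriv p p' s) (hq : HasCoeffDeriv q q' s) :
    HasCoeffDeriv (fun t => p t - q t) (p' - q') s := fun n => by
  simpa only [map_sub] using (hp n).fun_sub (hq n)

theorem mul (hp : HasCoeffDeriv p p' s) (hq : HasCoeffDeriv q q' s) :
    HasCoeffDeriv (fun t => p t * q t) (p' * q s + p s * q') s := fun n => by
  simp only [map_add, PowerSeries.coeff_mul, ← Finset.sum_add_distrib]
  exact HasDerivAt.fun_sum fun i _ => (hp i.1).mul (hq i.2)

theorem triple_product {v w u : ℝ → Fin 3 → PowerSeries ℝ} {v' w' u' : Fin 3 → PowerSeries ℝ}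
    (hv : ∀ i, HasCoeffDeriv (fun t => v t i) (v' i) s)
    (hw : ∀ i, HasCoeffDeriv (fun t => w t i) (w' i) s)
    (hu : ∀ i, HasCoeffDeriv (fun t => u t i) (u' i) s) :
    HasCoeffDeriv (fun t => triple (v t) (w t) (u t))
      (triple v' (w s) (u s) + triple (v s) w' (u s)
        + triple (v s) (w s) u') s := by
  have h1 := (((hv 0).mul (((hw 1).mul (hu 2)).sub ((hw 2).mul (hu 1)))).add
    ((hv 1).mul (((hw 2).mul (hu 0)).sub ((hw 0).mul (hu 2))))).add
    ((hv 2).mul (((hw 0).mul (hu 1)).sub ((hw 1).mul (hu 0))))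
  convert h1 using 1
  · rfl
  · simp only [triple]
    ring

end HasCoeffDeriv

theorem hasDerivAt_coord {f : ℝ → E3} {f' : E3} {s : ℝ} (hf : HasDerivAt f f' s) (i : Fin 3) :
    HasDerivAt (fun t => f t i) (f' i) s :=
  ((EuclideanSpace.proj i : E3 →L[ℝ] ℝ).hasFDerivAt.comp_hasDerivAt s hf)

theorem hasDerivAt_coeff_tripleSeries {V W : ℕ → ℝ → E3} {V' W' : ℕ → E3} {s : ℝ}
    (hV : ∀ n, HasDerivAt (V n) (V' n) s) (hW : ∀ n, HasDerivAt (W n) (W' n) s) (n : ℕ) :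
    HasDerivAt (fun t => PowerSeries.coeff n (tripleSeries (fun m => V m t) (fun m => W m t)))
      (PowerSeries.coeff n
        (triple (series V') (series fun m => W m s) (seriesDeriv fun m => V m s)
        + triple (series fun m => V m s) (series W') (seriesDeriv fun m => V m s)
        + triple (series fun m => V m s) (series fun m => W m s) (seriesDeriv V'))) s := by
  refine HasCoeffDeriv.triple_product (fun i m => ?_) (fun i m => ?_) (fun i m => ?_) n
  · simp only [coeff_series]
    exact hasDerivAt_coord (hV m) i
  · simp only [coeff_series]
    exact hasDerivAt_coord (hW m) i
  · simp only [coeff_seriesDeriv]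
    exact (hasDerivAt_coord (hV (m + 1)) i).mul_const _

/-! ### Degrees of the coefficients of the generating series -/

section CoeffDeg

variable {A : Type} {K : A → ℝ → ℝ} {n m : ℤ}

/-- Families of power series all of whose coefficients have a given degree. -/
def HasCoeffDeg (K : A → ℝ → ℝ) (n : ℤ) (p : A → ℝ → PowerSeries ℝ) : Prop :=
  ∀ l, HasDeg K n (fun a s => PowerSeries.coeff l (p a s))

theorem HasCoeffDeg.add (hK : ∀ a s, 0 < K a s) {p q : A → ℝ → PowerSeries ℝ}
    (hp : HasCoeffDeg K n p) (hq : HasCoeffDeg K n q) :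
    HasCoeffDeg K n (fun a s => p a s + q a s) := fun l => by
  simpa only [map_add] using (hp l).add hK (hq l)

theorem HasCoeffDeg.sub (hK : ∀ a s, 0 < K a s) {p q : A → ℝ → PowerSeries ℝ}
    (hp : HasCoeffDeg K n p) (hq : HasCoeffDeg K n q) :
    HasCoeffDeg K n (fun a s => p a s - q a s) := fun l => by
  simpa only [map_sub] using (hp l).sub hK (hq l)

theorem HasCoeffDeg.mul (hK : ∀ a s, 0 < K a s) {p q : A → ℝ → PowerSeries ℝ}
    (hp : HasCoeffDeg K n p) (hq : HasCoeffDeg K m q) :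
    HasCoeffDeg K (n + m) (fun a s => p a s * q a s) := fun l => by
  simp only [PowerSeries.coeff_mul]
  exact HasDeg.sum hK fun i _ => (hp i.1).mul hK (hq i.2)

theorem HasDeg.coord (hK : ∀ a s, 0 < K a s) {f : A → ℝ → E3} (hf : HasDeg K n f) (i : Fin 3) :
    HasDeg K n (fun a s => f a s i) := by
  have h1 : HasDeg K 0 (fun (_ : A) (_ : ℝ) => EuclideanSpace.single i (1 : ℝ)) :=
    HasDeg.const (c := fun _ => EuclideanSpace.single i (1 : ℝ))
      (C := ‖EuclideanSpace.single i (1 : ℝ)‖) fun _ => le_rfl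
  simpa [EuclideanSpace.inner_single_right] using hf.inner hK h1

/-- The x-derivative removes V_0, the only coefficient of v not assumed to decay, so the triple
product decays although v and w need only have degree 0. -/
theorem hasDeg_coeff_tripleSeries (hK : ∀ a s, 0 < K a s) {V W : A → ℕ → ℝ → E3}
    (hV : ∀ j, HasDeg K 0 (fun a => V a j)) (hV' : ∀ j, HasDeg K 1 (fun a => V a (j + 1)))
    (hW : ∀ j, HasDeg K 0 (fun a => W a j)) (l : ℕ) :
    HasDeg K 1 (fun a s =>
      PowerSeries.coeff l (tripleSeries (fun j => V a j s) (fun j => W a j s))) := by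
  have hv : ∀ i, HasCoeffDeg K 0 (fun a s => series (fun j => V a j s) i) := fun i l => by
    simp only [coeff_series]
    exact (hV l).coord hK i
  have hw : ∀ i, HasCoeffDeg K 0 (fun a s => series (fun j => W a j s) i) := fun i l => by
    simp only [coeff_series]
    exact (hW l).coord hK i
  have hu : ∀ i, HasCoeffDeg K 1 (fun a s => seriesDeriv (fun j => V a j s) i) := fun i l => by
    simp only [coeff_seriesDeriv]
    have h1 := ((hV' l).coord hK i).const_smul ((l : ℝ) + 1)
    simpa only [smul_eq_mul, mul_comm] using h1
  have h1 := ((((hv 0).mul hK (((hw 1).mul hK (hu 2)).sub hK ((hw 2).mul hK (hu 1)))).add hK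
    ((hv 1).mul hK (((hw 2).mul hK (hu 0)).sub hK ((hw 0).mul hK (hu 2))))).add hK
    ((hv 2).mul hK (((hw 0).mul hK (hu 1)).sub hK ((hw 1).mul hK (hu 0))))) l
  exact h1

end CoeffDeg

end
end Filament
namespace Filament
noncomputable section

/-! ### Smooth functions of two variables -/

section TwoVariables

variable {E E' : Type*} [NormedAddCommGroup E] [NormedSpace ℝ E]
  [NormedAddCommGroup E'] [NormedSpace ℝ E'] {F : ℝ → ℝ → E}

/-- Joint smoothness of a function of two real variables. -/
def Smooth₂ (F : ℝ → ℝ → E) : Prop := ContDiff ℝ ∞ (fun p : ℝ × ℝ => F p.1 p.2)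

/-- The partial derivative by the first variable. -/
def d₁ (F : ℝ → ℝ → E) (ε s : ℝ) : E := deriv (fun e => F e s) ε

theorem hasDerivAt_mk_fst (ε s : ℝ) : HasDerivAt (fun e : ℝ => (e, s)) ((1, 0) : ℝ × ℝ) ε :=
  (hasDerivAt_id ε).prodMk (hasDerivAt_const ε s)

theorem hasDerivAt_mk_snd (ε s : ℝ) : HasDerivAt (fun t : ℝ => (ε, t)) ((0, 1) : ℝ × ℝ) s :=
  (hasDerivAt_const s ε).prodMk (hasDerivAt_id s)

namespace Smooth₂

variable (hF : Smooth₂ F)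

include hF

theorem hasFDerivAt (p : ℝ × ℝ) : HasFDerivAt (fun p : ℝ × ℝ => F p.1 p.2)
    (fderiv ℝ (fun p : ℝ × ℝ => F p.1 p.2) p) p :=
  (hF.differentiable (by simp) p).hasFDerivAt

theorem hasDerivAt_fderiv_fst (ε s : ℝ) : HasDerivAt (fun e => F e s)
    (fderiv ℝ (fun p : ℝ × ℝ => F p.1 p.2) (ε, s) (1, 0)) ε :=
  HasFDerivAt.comp_hasDerivAt (l := fun p : ℝ × ℝ => F p.1 p.2) ε (hF.hasFDerivAt (ε, s))
    (hasDerivAt_mk_fst ε s)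

theorem hasDerivAt_fderiv_snd (ε s : ℝ) : HasDerivAt (F ε)
    (fderiv ℝ (fun p : ℝ × ℝ => F p.1 p.2) (ε, s) (0, 1)) s :=
  (hF.hasFDerivAt (ε, s)).comp_hasDerivAt s (hasDerivAt_mk_snd ε s)

theorem hasDerivAt_d₁ (ε s : ℝ) : HasDerivAt (fun e => F e s) (d₁ F ε s) ε :=
  (hF.hasDerivAt_fderiv_fst ε s).differentiableAt.hasDerivAt

theorem d₁_eq (ε s : ℝ) : d₁ F ε s = fderiv ℝ (fun p : ℝ × ℝ => F p.1 p.2) (ε, s) (1, 0) :=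
  (hF.hasDerivAt_fderiv_fst ε s).deriv

theorem deriv_eq (ε s : ℝ) :
    _root_.deriv (F ε) s = fderiv ℝ (fun p : ℝ × ℝ => F p.1 p.2) (ε, s) (0, 1) :=
  (hF.hasDerivAt_fderiv_snd ε s).deriv

theorem contDiff_fderiv : ContDiff ℝ ∞ (fderiv ℝ (fun p : ℝ × ℝ => F p.1 p.2)) :=
  ContDiff.fderiv_right hF (by simp)

theorem partial_fst : Smooth₂ (d₁ F) := by
  have h1 : (fun p : ℝ × ℝ => d₁ F p.1 p.2) =
      fun p => fderiv ℝ (fun p : ℝ × ℝ => F p.1 p.2) p (1, 0) := funext fun p => hF.d₁_eq p.1 p.2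
  rw [Smooth₂, h1]
  exact hF.contDiff_fderiv.clm_apply contDiff_const

theorem partial_snd : Smooth₂ (fun ε => deriv (F ε)) := by
  have h1 : (fun p : ℝ × ℝ => _root_.deriv (F p.1) p.2) =
      fun p => fderiv ℝ (fun p : ℝ × ℝ => F p.1 p.2) p (0, 1) :=
    funext fun p => hF.deriv_eq p.1 p.2
  rw [Smooth₂, h1]
  exact hF.contDiff_fderiv.clm_apply contDiff_const

theorem slice (ε : ℝ) : ContDiff ℝ ∞ (F ε) :=
  ContDiff.comp (g := fun p : ℝ × ℝ => F p.1 p.2) (f := fun s => (ε, s)) hF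
    (contDiff_const.prodMk contDiff_id)

/-- Symmetry of the second derivative. It yields both the linearized Lax equation and δT = (δγ)'. -/
theorem deriv_d₁ (ε s : ℝ) : _root_.deriv (d₁ F ε) s = d₁ (fun e => _root_.deriv (F e)) ε s := by
  set G := fderiv ℝ (fun p : ℝ × ℝ => F p.1 p.2) with hG
  have hD : HasFDerivAt G (fderiv ℝ G (ε, s)) (ε, s) :=
    (hF.contDiff_fderiv.differentiable (by simp) (ε, s)).hasFDerivAt
  have h3 : HasDerivAt (fun t => G (ε, t) (1, 0)) (fderiv ℝ G (ε, s) (0, 1) (1, 0)) s :=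
    ((ContinuousLinearMap.apply ℝ E ((1, 0) : ℝ × ℝ)).hasFDerivAt.comp_hasDerivAt s
      (HasFDerivAt.comp_hasDerivAt (l := G) s hD (hasDerivAt_mk_snd ε s)))
  have h4 : HasDerivAt (fun e => G (e, s) (0, 1)) (fderiv ℝ G (ε, s) (1, 0) (0, 1)) ε :=
    ((ContinuousLinearMap.apply ℝ E ((0, 1) : ℝ × ℝ)).hasFDerivAt.comp_hasDerivAt ε
      (HasFDerivAt.comp_hasDerivAt (l := G) ε hD (hasDerivAt_mk_fst ε s)))
  have hsymm : IsSymmSndFDerivAt ℝ (fun p : ℝ × ℝ => F p.1 p.2) (ε, s) :=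
    ContDiffAt.isSymmSndFDerivAt (ContDiff.contDiffAt hF) (by
      rw [minSmoothness_of_isRCLikeNormedField]
      exact WithTop.coe_le_coe.2 (le_top (a := (2 : ℕ∞))))
  rw [funext (hF.d₁_eq ε), h3.deriv, d₁, funext fun e => hF.deriv_eq e s, h4.deriv]
  exact hsymm (0, 1) (1, 0)

theorem hasDerivAt_partial (ε s : ℝ) :
    HasDerivAt (fun e => _root_.deriv (F e) s) (_root_.deriv (d₁ F ε) s) ε := by
  rw [hF.deriv_d₁]
  exact hF.partial_snd.hasDerivAt_d₁ ε s

end Smooth₂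

/-- Differentiation under the integral sign. -/
theorem hasDerivAt_integral_of_bound {u : ℝ → ℝ → ℝ} {C : ℝ} (hu : Smooth₂ u)
    (hC : ∀ ε : ℝ, |ε| ≤ 1 → ∀ s, ‖d₁ u ε s‖ ≤ C * (1 + s ^ 2)⁻¹) (hi : Integrable (u 0)) :
    HasDerivAt (fun ε => ∫ s, u ε s) (∫ s, d₁ u 0 s) 0 := by
  have hs : {ε : ℝ | |ε| ≤ 1} ∈ 𝓝 (0 : ℝ) := by
    filter_upwards [Metric.closedBall_mem_nhds (0 : ℝ) one_pos] with ε hε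
    simpa using hε
  exact (hasDerivAt_integral_of_dominated_loc_of_deriv_le hs
    (Eventually.of_forall fun ε => (hu.slice ε).continuous.aestronglyMeasurable) hi
    (hu.partial_fst.slice 0).continuous.aestronglyMeasurable
    (ae_of_all _ fun s ε hε => hC ε hε s) (integrable_inv_one_add_sq.const_mul C)
    (ae_of_all _ fun s ε _ => hu.hasDerivAt_d₁ ε s)).2

end TwoVariables

/-! ### Variations of the Lax sequence -/

/-- The parameters of a path at which uniform bounds hold. -/
abbrev PathParam : Type := {ε : ℝ // |ε| ≤ 1}

section LaxVariation

variable {T : ℝ → ℝ → E3}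

theorem Smooth₂.cross {u v : ℝ → ℝ → E3} (hu : Smooth₂ u) (hv : Smooth₂ v) :
    Smooth₂ (fun ε s => Filament.cross (u ε s) (v ε s)) :=
  Filament.cross.isBoundedBilinearMap.contDiff.comp (ContDiff.prodMk hu hv)

theorem smooth₂_lax (sT : Smooth₂ T) (m : ℕ) : Smooth₂ (fun ε => lax (T ε) m) := by
  induction m using Nat.strong_induction_on with
  | _ m ih =>
    cases m with
    | zero =>
      rw [show (fun ε => lax (T ε) 0) = fun ε s => -T ε s from
        funext fun ε => funext (lax_zero (T ε))]
      exact ContDiff.neg sT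
    | succ m =>
      rw [show (fun ε => lax (T ε) (m + 1)) = fun ε s =>
          -cross (T ε s) (deriv (lax (T ε) m) s) + laxEnergy (T ε) m s • T ε s from
        funext fun ε => funext (lax_succ (T ε) m)]
      have h1 := sT.cross (ih m (by omega)).partial_snd
      have h2 : Smooth₂ (fun ε => laxEnergy (T ε) m) := by
        refine contDiff_const.mul (ContDiff.sum fun i hi => ?_)
        rw [Finset.mem_range] at hi
        exact ContDiff.inner ℝ (ih (i + 1) (by omega)) (ih (m - i) (by omega))
      exact (ContDiff.neg h1).add (ContDiff.smul h2 sT)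

theorem smooth₂_laxEnergy (sT : Smooth₂ T) (m : ℕ) : Smooth₂ (fun ε => laxEnergy (T ε) m) :=
  contDiff_const.mul (ContDiff.sum fun _ _ =>
    ContDiff.inner ℝ (smooth₂_lax sT _) (smooth₂_lax sT _))

/-- The variation of the Lax sequence. -/
def laxVar (T : ℝ → ℝ → E3) (m : ℕ) : ℝ → ℝ → E3 := d₁ (fun ε => lax (T ε) m)

theorem hasDerivAt_lax_fst (sT : Smooth₂ T) (m : ℕ) (ε s : ℝ) :
    HasDerivAt (fun e => lax (T e) m s) (laxVar T m ε s) ε :=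
  (smooth₂_lax sT m).hasDerivAt_d₁ ε s

theorem laxVar_zero (sT : Smooth₂ T) (ε s : ℝ) : laxVar T 0 ε s = -d₁ T ε s := by
  have h1 := hasDerivAt_lax_fst sT 0 ε s
  simp only [lax_zero] at h1
  exact h1.unique (sT.hasDerivAt_d₁ ε s).fun_neg

/-- The linearized Lax equation. -/
theorem hasDerivAt_laxVar (sT : Smooth₂ T) (hT : ∀ ε s, inner ℝ (T ε s) (T ε s) = (1 : ℝ))
    (m : ℕ) (ε s : ℝ) : HasDerivAt (laxVar T m ε) (cross (d₁ T ε s) (lax (T ε) (m + 1) s)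
      + cross (T ε s) (laxVar T (m + 1) ε s)) s := by
  have h1 := (smooth₂_lax sT m).hasDerivAt_partial ε s
  rw [show (fun e => deriv (lax (T e) m) s) = fun e => cross (T e s) (lax (T e) (m + 1) s) from
    funext fun e => (hasDerivAt_lax (sT.slice e) (hT e) m s).deriv] at h1
  have h2 := hasDerivAt_cross (sT.hasDerivAt_d₁ ε s) (hasDerivAt_lax_fst sT (m + 1) ε s)
  rw [add_comm, ← h1.unique h2]
  exact hasDerivAt_of_contDiff ((smooth₂_lax sT m).partial_fst.slice ε) s

theorem d₁_laxEnergy (sT : Smooth₂ T) (m : ℕ) (ε s : ℝ) :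
    d₁ (fun ε => laxEnergy (T ε) m) ε s = (1 / 2) * ∑ i ∈ Finset.range m,
      (inner ℝ (lax (T ε) (i + 1) s) (laxVar T (m - i) ε s)
        + inner ℝ (laxVar T (i + 1) ε s) (lax (T ε) (m - i) s)) := by
  have h1 : HasDerivAt (fun e => laxEnergy (T e) m s) _ ε :=
    (HasDerivAt.fun_sum fun i (_ : i ∈ Finset.range m) =>
      (hasDerivAt_lax_fst sT (i + 1) ε s).inner ℝ
        (hasDerivAt_lax_fst sT (m - i) ε s)).const_mul (1 / 2)
  exact h1.deriv

/-- Differentiates e_m = T·V_{m+1} instead of the defining sum: the sum shows that δe_m decays, this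
form enters the integral identity. -/
theorem d₁_laxEnergy' (sT : Smooth₂ T) (hT : ∀ ε s, inner ℝ (T ε s) (T ε s) = (1 : ℝ)) (m : ℕ)
    (ε s : ℝ) : d₁ (fun ε => laxEnergy (T ε) m) ε s
      = inner ℝ (T ε s) (laxVar T (m + 1) ε s) + inner ℝ (d₁ T ε s) (lax (T ε) (m + 1) s) := by
  have h1 := (sT.hasDerivAt_d₁ ε s).inner ℝ (hasDerivAt_lax_fst sT (m + 1) ε s)
  simp only [inner_lax_succ (hT _)] at h1
  exact h1.deriv

theorem laxVar_succ (sT : Smooth₂ T) (m : ℕ) (ε s : ℝ) :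
    laxVar T (m + 1) ε s = -(cross (T ε s) (deriv (laxVar T m ε) s)
        + cross (d₁ T ε s) (deriv (lax (T ε) m) s))
      + (laxEnergy (T ε) m s • d₁ T ε s + d₁ (fun ε => laxEnergy (T ε) m) ε s • T ε s) := by
  have h1 := hasDerivAt_lax_fst sT (m + 1) ε s
  simp only [lax_succ] at h1
  exact h1.unique ((hasDerivAt_cross (sT.hasDerivAt_d₁ ε s)
    ((smooth₂_lax sT m).hasDerivAt_partial ε s)).fun_neg.fun_add
    (((smooth₂_laxEnergy sT m).hasDerivAt_d₁ ε s).fun_smul (sT.hasDerivAt_d₁ ε s)))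

theorem sum_inner_laxVar (sT : Smooth₂ T) (hT : ∀ ε s, inner ℝ (T ε s) (T ε s) = (1 : ℝ))
    (m : ℕ) (ε s : ℝ) : ∑ p ∈ Finset.HasAntidiagonal.antidiagonal m,
      inner ℝ (lax (T ε) p.1 s) (laxVar T p.2 ε s) = (0 : ℝ) := by
  have h1 := HasDerivAt.fun_sum fun (p : ℕ × ℕ)
    (_ : p ∈ Finset.HasAntidiagonal.antidiagonal m) =>
      (hasDerivAt_lax_fst sT p.1 ε s).inner ℝ (hasDerivAt_lax_fst sT p.2 ε s)
  simp only [sum_inner_lax (hT _), Finset.sum_add_distrib] at h1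
  have h2 := h1.unique (hasDerivAt_const _ _)
  rw [← Finset.Nat.sum_antidiagonal_swap
    (f := fun p : ℕ × ℕ => (inner ℝ (laxVar T p.1 ε s) (lax (T ε) p.2 s) : ℝ))] at h2
  simp only [Prod.fst_swap, Prod.snd_swap] at h2
  simp only [fun p : ℕ × ℕ => real_inner_comm (lax (T ε) p.1 s) (laxVar T p.2 ε s)] at h2
  linarith

/-- Variations of unit vector fields with uniform bounds. -/
structure IsSphericalVariation (T : ℝ → ℝ → E3) (K : PathParam → ℝ → ℝ) : Prop where
  smooth : Smooth₂ T
  unit : ∀ ε s, inner ℝ (T ε s) (T ε s) = (1 : ℝ)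
  weight : IsWeight K
  deg : HasDeg K 0 (fun ε : PathParam => T ε)
  deg_deriv : HasDeg K 1 (fun ε : PathParam => deriv (T ε))
  deg_var : HasDeg K 1 (fun ε : PathParam => d₁ T ε)

namespace IsSphericalVariation

variable {K : PathParam → ℝ → ℝ} (h : IsSphericalVariation T K)

include h

theorem hasDeg_lax (m : ℕ) : HasDeg K 0 (fun ε : PathParam => lax (T ε) m) :=
  Filament.hasDeg_lax h.weight h.deg h.deg_deriv m

theorem hasDeg_lax_succ (m : ℕ) : HasDeg K 1 (fun ε : PathParam => lax (T ε) (m + 1)) :=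
  Filament.hasDeg_lax_succ h.weight h.deg h.deg_deriv m

theorem hasDeg_laxEnergy (m : ℕ) : HasDeg K 1 (fun ε : PathParam => laxEnergy (T ε) m) := by
  have h1 := h.deg.inner h.weight.pos (h.hasDeg_lax_succ m)
  simp only [inner_lax_succ (h.unit _)] at h1
  exact h1

/-- Each term pairs a variation with some V_i, i ≥ 1, so degree 0 for the variations suffices. Only
indices up to m are assumed, which makes the lemma usable inside the induction for `laxVar`. -/
theorem hasDeg_d₁_laxEnergy_of {m : ℕ}
    (ih : ∀ j ≤ m, HasDeg K 0 (fun ε : PathParam => laxVar T j ε)) :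
    HasDeg K 1 (fun ε : PathParam => d₁ (fun ε => laxEnergy (T ε) m) ε) := by
  rw [funext fun ε : PathParam => funext (d₁_laxEnergy h.smooth m ε)]
  refine HasDeg.const_smul (1 / 2) (HasDeg.sum h.weight.pos fun i hi => ?_)
  rw [Finset.mem_range] at hi
  have h2 := h.hasDeg_lax_succ (m - i - 1)
  rw [show m - i - 1 + 1 = m - i by omega] at h2
  exact ((h.hasDeg_lax_succ i).inner h.weight.pos (ih (m - i) (by omega))).add h.weight.pos
    ((ih (i + 1) (by omega)).inner h.weight.pos h2)

theorem hasDeg_laxVar (m : ℕ) : HasDeg K 0 (fun ε : PathParam => laxVar T m ε) := by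
  have hv := h.deg_var.of_le h.weight zero_le_one
  have hp := h.weight.pos
  induction m using Nat.strong_induction_on with
  | _ m ih =>
    cases m with
    | zero =>
      rw [funext fun ε : PathParam => funext (laxVar_zero h.smooth ε)]
      exact hv.neg
    | succ m =>
      rw [funext fun ε : PathParam => funext (laxVar_succ h.smooth m ε)]
      have he := (h.hasDeg_d₁_laxEnergy_of (m := m) fun j hj => ih j (by omega)).of_le
        h.weight zero_le_one
      have he' := (h.hasDeg_laxEnergy m).of_le h.weight zero_le_one
      exact (((h.deg.cross hp (ih m (by omega)).deriv).add hp
        (hv.cross hp (h.hasDeg_lax m).deriv)).neg).add hp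
        ((he'.smul hp hv).add hp (he.smul hp h.deg))

theorem hasDeg_d₁_laxEnergy (m : ℕ) :
    HasDeg K 1 (fun ε : PathParam => d₁ (fun ε => laxEnergy (T ε) m) ε) :=
  h.hasDeg_d₁_laxEnergy_of fun j _ => h.hasDeg_laxVar j

theorem hasDerivAt_integral_laxEnergy (m : ℕ) :
    HasDerivAt (fun ε => ∫ s, laxEnergy (T ε) m s)
      (∫ s, d₁ (fun ε => laxEnergy (T ε) m) 0 s) 0 := by
  obtain ⟨C, _, hC⟩ := (h.hasDeg_d₁_laxEnergy m).rapid h.weight le_rfl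
  exact hasDerivAt_integral_of_bound (smooth₂_laxEnergy h.smooth m)
    (fun ε hε s => hC ⟨ε, hε⟩ s)
    ((h.hasDeg_laxEnergy m).integrable h.weight le_rfl ⟨0, by simp⟩)

/-- The variation of the integrals of the tangential components. -/
theorem integral_d₁_laxEnergy (n : ℕ) :
    ∫ s, d₁ (fun ε => laxEnergy (T ε) (n + 1)) 0 s
      = -((n : ℝ) + 1) * ∫ s, (inner ℝ (d₁ T 0 s) (lax (T 0) (n + 2) s) : ℝ) := by
  have hp := h.weight.pos
  let a : PathParam := ⟨0, by simp⟩
  have hd : HasDeg K 1 (fun (ε : PathParam) s =>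
      (inner ℝ (d₁ T ε s) (lax (T ε) (n + 2) s) : ℝ)) :=
    (h.deg_var.inner hp (h.hasDeg_lax_succ (n + 1))).of_le h.weight (by norm_num)
  -- The n-th coefficient of det(v, δv, ∂_x v) vanishes at both ends, so the integral of its
  -- derivative is zero.
  have hI := (hasDeg_coeff_tripleSeries hp (V := fun (ε : PathParam) m => lax (T ε) m)
    (W := fun (ε : PathParam) m => laxVar T m ε) h.hasDeg_lax h.hasDeg_lax_succ
    h.hasDeg_laxVar n).integral_deriv_eq_zero h.weight le_rfl a
    (f' := fun s => ((n : ℝ) + 2) * inner ℝ (d₁ T 0 s) (lax (T 0) (n + 2) s)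
      + inner ℝ (T 0 s) (laxVar T (n + 2) 0 s)) fun s => by
        have h1 := hasDerivAt_coeff_tripleSeries
          (fun m => hasDerivAt_lax (h.smooth.slice 0) (h.unit 0) m s)
          (fun m => hasDerivAt_laxVar h.smooth h.unit m 0 s) n
        rw [coeff_triple_lax (T := T 0 s) (dT := d₁ T 0 s)] at h1
        · exact h1
        · rw [lax_zero, map_neg, cross_self_eq_zero, neg_zero]
        · exact fun n => rfl
        · rw [lax_zero, laxVar_zero h.smooth, map_neg, map_neg, cross_swap]
          simp
        · exact fun n => rfl
        · exact fun n => sum_inner_lax (h.unit 0) n s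
        · exact fun n => sum_inner_laxVar h.smooth h.unit n 0 s
  -- Substituting T·δV_{n+2} = δe_{n+1} - δT·V_{n+2} lowers the factor n + 2 to n + 1.
  have h2 : (fun s => ((n : ℝ) + 2) * inner ℝ (d₁ T 0 s) (lax (T 0) (n + 2) s)
      + inner ℝ (T 0 s) (laxVar T (n + 2) 0 s)) = fun s =>
        ((n : ℝ) + 1) * inner ℝ (d₁ T 0 s) (lax (T 0) (n + 2) s)
          + d₁ (fun ε => laxEnergy (T ε) (n + 1)) 0 s := by
    funext s
    rw [d₁_laxEnergy' h.smooth h.unit]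
    ring
  rw [h2, integral_add ((hd.integrable h.weight le_rfl a).const_mul _)
    ((h.hasDeg_d₁_laxEnergy (n + 1)).integrable h.weight le_rfl a), integral_const_mul] at hI
  linarith

end IsSphericalVariation

end LaxVariation

end
end Filament
namespace Filament
noncomputable section

variable {γ₀ : ℝ → E3}

/-! ### Paths of curves -/

namespace IsPath

variable {Γ : ℝ → BAL γ₀} {g h : ℝ → ℝ → ℝ} (hp : IsPath Γ g h)

include hp

theorem isControlled : IsControlled (fun ε : PathParam => (Γ ε).1) where
  regular ε := (Γ ε).2.isRegular
  weight :=
    { pos := fun ε => (Γ ε).2.isRegular.curvature_pos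
      decay := fun k => by
        obtain ⟨C, hC⟩ := hp.curvature_decay k
        exact ⟨C, fun ε => hC ε ε.2⟩
      deg := HasDeg.of_iteratedDeriv (fun ε : PathParam => (Γ ε).2.isRegular.curvature_pos)
        (fun ε => (Γ ε).2.isRegular.contDiff_curvature) fun j => by
          obtain ⟨C, k, hC⟩ := hp.curvature_bound j
          exact ⟨C, k, fun ε s => by simpa using hC ε ε.2 s⟩ }
  hasDeg_torsion := HasDeg.of_iteratedDeriv (fun ε : PathParam => (Γ ε).2.isRegular.curvature_pos)
    (fun ε => (Γ ε).2.isRegular.contDiff_torsion) fun j => by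
      obtain ⟨C, k, hC⟩ := hp.torsion_bound j
      exact ⟨C, k, fun ε s => by simpa using hC ε ε.2 s⟩

theorem smooth₂ : Smooth₂ (fun ε => (Γ ε).1) := hp.smooth

theorem d₁_eq (ε : PathParam) (s : ℝ) : d₁ (fun ε => (Γ ε).1) ε s
    = antideriv (fun t => curvature (Γ ε).1 t * g ε t) s • tangent (Γ ε).1 s
      + g ε s • normal (Γ ε).1 s + h ε s • binormal (Γ ε).1 s :=
  (hp.velocity ε ε.2 s).deriv

/-- Smoothness of g in s is not part of `IsPath`; it is recovered by reading g as the normal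
component of the velocity of a jointly smooth family. -/
theorem hasDeg_nc :
    HasDeg (fun ε : PathParam => curvature (Γ ε).1) 1 (fun ε : PathParam => g ε) := by
  refine HasDeg.of_iteratedDeriv hp.isControlled.weight.pos (fun ε => ?_) fun j => ?_
  · have h1 : g ε = fun s => inner ℝ (d₁ (fun ε => (Γ ε).1) ε s) (normal (Γ ε).1 s) := by
      funext s
      have hF := (Γ ε).2.isRegular.isFrame s
      rw [hp.d₁_eq, inner_add_left, inner_add_left, inner_smul_left, inner_smul_left,
        inner_smul_left, hF.tn, hF.nn, hF.bn]
      simp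
    rw [h1]
    exact (hp.smooth₂.partial_fst.slice ε).inner ℝ (Γ ε).2.isRegular.contDiff_normal
  · obtain ⟨C, k, hC⟩ := hp.normal_bound j
    exact ⟨C, k, fun ε s => by simpa using hC ε ε.2 s⟩

theorem hasDeg_bc :
    HasDeg (fun ε : PathParam => curvature (Γ ε).1) 1 (fun ε : PathParam => h ε) := by
  refine HasDeg.of_iteratedDeriv hp.isControlled.weight.pos (fun ε => ?_) fun j => ?_
  · have h1 : h ε = fun s => inner ℝ (d₁ (fun ε => (Γ ε).1) ε s) (binormal (Γ ε).1 s) := by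
      funext s
      have hF := (Γ ε).2.isRegular.isFrame s
      rw [hp.d₁_eq, inner_add_left, inner_add_left, inner_smul_left, inner_smul_left,
        inner_smul_left, hF.tb, hF.nb, hF.bb]
      simp
    rw [h1]
    exact (hp.smooth₂.partial_fst.slice ε).inner ℝ (Γ ε).2.isRegular.contDiff_binormal
  · obtain ⟨C, k, hC⟩ := hp.binormal_bound j
    exact ⟨C, k, fun ε s => by simpa using hC ε ε.2 s⟩

theorem hasDeg_kappa_nc : HasDeg (fun ε : PathParam => curvature (Γ ε).1) 2
    (fun ε : PathParam => fun s => curvature (Γ ε).1 s * g ε s) :=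
  hp.isControlled.weight.deg.mul hp.isControlled.weight.pos hp.hasDeg_nc

theorem hasDeg_antideriv : HasDeg (fun ε : PathParam => curvature (Γ ε).1) 0
    (fun ε : PathParam => antideriv fun s => curvature (Γ ε).1 s * g ε s) :=
  hp.hasDeg_kappa_nc.antideriv hp.isControlled.weight (by norm_num)

theorem hasDeg_d₁ : HasDeg (fun ε : PathParam => curvature (Γ ε).1) 0
    (fun ε : PathParam => d₁ (fun ε => (Γ ε).1) ε) := by
  have hc := hp.isControlled
  rw [funext fun ε : PathParam => funext (hp.d₁_eq ε)]
  exact ((hp.hasDeg_antideriv.smul hc.weight.pos hc.hasDeg_tangent).add hc.weight.pos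
    ((hp.hasDeg_nc.smul hc.weight.pos hc.hasDeg_normal).of_le hc.weight (by norm_num))).add
    hc.weight.pos
    ((hp.hasDeg_bc.smul hc.weight.pos hc.hasDeg_binormal).of_le hc.weight (by norm_num))

theorem deriv_d₁ (ε s : ℝ) : deriv (d₁ (fun ε => (Γ ε).1) ε) s
    = d₁ (fun ε => tangent (Γ ε).1) ε s := hp.smooth₂.deriv_d₁ ε s

theorem hasDerivAt_d₁ (ε s : ℝ) : HasDerivAt (d₁ (fun ε => (Γ ε).1) ε)
    (d₁ (fun ε => tangent (Γ ε).1) ε s) s := by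
  rw [← hp.deriv_d₁]
  exact hasDerivAt_of_contDiff (hp.smooth₂.partial_fst.slice ε) s

/-- The velocity itself has degree 0 only, because ∂_s⁻¹(κ g) need not decay. In its s-derivative
the tangential part κ g - κ g cancels, the infinitesimal form of preserving arclength, and the rest
has degree 1. -/
theorem hasDeg_d₁_tangent : HasDeg (fun ε : PathParam => curvature (Γ ε).1) 1
    (fun ε : PathParam => d₁ (fun ε => tangent (Γ ε).1) ε) := by
  have hc := hp.isControlled
  have hK := hc.weight
  have h1 : (fun ε : PathParam => d₁ (fun ε => tangent (Γ ε).1) (ε : ℝ)) =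
      fun (ε : PathParam) s =>
      (deriv (g ε) s + (curvature (Γ ε).1 s * antideriv (fun t => curvature (Γ ε).1 t * g ε t) s
        - torsion (Γ ε).1 s * h ε s)) • normal (Γ ε).1 s
      + (deriv (h ε) s + torsion (Γ ε).1 s * g ε s) • binormal (Γ ε).1 s := by
    funext ε s
    have h2 := (Γ ε).2.isRegular.hasDerivAt_comb
      (hp.hasDeg_kappa_nc.hasDerivAt_antideriv hK (by norm_num) ε s)
      (hasDerivAt_of_contDiff (hp.hasDeg_nc.smooth ε) s)
      (hasDerivAt_of_contDiff (hp.hasDeg_bc.smooth ε) s)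
    rw [← hp.deriv_d₁, funext (hp.d₁_eq ε), h2.deriv, sub_self, zero_smul, zero_add, add_sub_assoc]
  rw [h1]
  have hκf := (hK.deg.mul hK.pos hp.hasDeg_antideriv).of_le hK (m := 1) (by norm_num)
  have hτh := (hc.hasDeg_torsion.mul hK.pos hp.hasDeg_bc).of_le hK (m := 1) (by norm_num)
  have hτg := (hc.hasDeg_torsion.mul hK.pos hp.hasDeg_nc).of_le hK (m := 1) (by norm_num)
  exact (((hp.hasDeg_nc.deriv.add hK.pos (hκf.sub hK.pos hτh)).smul hK.pos
    hc.hasDeg_normal).of_le hK (by norm_num)).add hK.pos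
    (((hp.hasDeg_bc.deriv.add hK.pos hτg).smul hK.pos hc.hasDeg_binormal).of_le hK (by norm_num))

theorem isSphericalVariation : IsSphericalVariation (fun ε => tangent (Γ ε).1)
    (fun ε : PathParam => curvature (Γ ε).1) where
  smooth := hp.smooth₂.partial_snd
  unit ε := (Γ ε).2.arclength.inner_tangent
  weight := hp.isControlled.weight
  deg := hp.isControlled.hasDeg_tangent
  deg_deriv := hp.isControlled.hasDeg_deriv_tangent
  deg_var := hp.hasDeg_d₁_tangent

theorem d₁_eq_lift {Y : VField γ₀} (hg : g 0 = Y.nc (Γ 0)) (hh : h 0 = Y.bc (Γ 0)) (s : ℝ) :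
    d₁ (fun ε => (Γ ε).1) 0 s = Y.lift (Γ 0) s := by
  rw [hp.d₁_eq ⟨0, by simp⟩]
  simp only [hg, hh]
  rfl

end IsPath

/-! ### The forms `ζ_n` and the functionals `I_n` -/

/-- The pairing Ω₀ is a triple product with T. By the Lax equation the integrand is V_n'·℘Y, ready
for integration by parts. -/
theorem zeta_eq (n : ℕ) (Y : VField γ₀) (γ : BAL γ₀) : zeta n Y γ
    = ∫ s, (inner ℝ (cross (tangent γ.1 s) (lax (tangent γ.1) (n + 1) s)) (Y.lift γ s) : ℝ) := by
  rw [lax_eq_lift]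
  simp only [VField.inner_cross_lift]
  refine integral_congr_ae (ae_of_all _ fun s => ?_)
  change -(Xsym n).bc γ s * Y.nc γ s + (Xsym n).nc γ s * Y.bc γ s = _
  ring

theorem DsInv_kappa_Xsym (n : ℕ) (γ : BAL γ₀) :
    DsInv (kappa * (Xsym n : VField γ₀).nc) γ = laxEnergy (tangent γ.1) n := by
  funext s
  have hF := γ.2.isRegular.isFrame s
  rw [← inner_lax_succ γ.2.arclength.inner_tangent, lax_eq_lift, VField.lift, inner_add_right,
    inner_add_right, inner_smul_right, inner_smul_right, inner_smul_right, hF.tt, hF.tn, hF.tb]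
  ring

theorem hasDeg_laxEnergy_tangent (n : ℕ) (γ : BAL γ₀) :
    HasDeg (fun _ : Unit => curvature γ.1) 1 (fun _ => laxEnergy (tangent γ.1) n) := by
  have hc := γ.2.isControlled
  have h1 := hc.hasDeg_tangent.inner hc.weight.pos
    (hasDeg_lax_succ hc.weight hc.hasDeg_tangent hc.hasDeg_deriv_tangent n)
  simp only [inner_lax_succ γ.2.arclength.inner_tangent] at h1
  exact h1

theorem hasDerivAt_laxEnergy (n : ℕ) (γ : BAL γ₀) (s : ℝ) :
    HasDerivAt (laxEnergy (tangent γ.1) n) (curvature γ.1 s * (Xsym n : VField γ₀).nc γ s) s := by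
  rw [← DsInv_kappa_Xsym]
  exact ((Xsym n : VField γ₀).hasDeg_kappa_nc γ).hasDerivAt_antideriv γ.2.isControlled.weight
    (by norm_num) () s

/-- The formula of Langer and Perline. -/
theorem consMotion_eq (n : ℕ) (γ : BAL γ₀) :
    consMotion (n + 2) γ = (1 / ((n : ℝ) + 1)) * ∫ s, laxEnergy (tangent γ.1) (n + 1) s := by
  have hK := γ.2.isControlled.weight
  have hE := hasDeg_laxEnergy_tangent (n + 1) γ
  have hsκg : HasDeg (fun _ : Unit => curvature γ.1) 2
      (fun _ s => s * (curvature γ.1 s * (Xsym (n + 1) : VField γ₀).nc γ s)) :=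
    HasDeg.id.mul hK.pos ((Xsym (n + 1) : VField γ₀).hasDeg_kappa_nc γ)
  -- The derivative of s e_{n+1} is e_{n+1} + s κ g_{n+1}; the second summand is the integrand of
  -- ζ_{n+1}(sκB).
  have hI := (HasDeg.id.mul hK.pos hE).integral_deriv_eq_zero hK (by norm_num) ()
    (fun s => (hasDerivAt_id s).mul (hasDerivAt_laxEnergy (n + 1) γ s))
  simp only [id, one_mul] at hI
  rw [integral_add (hE.integrable hK le_rfl ()) (hsκg.integrable hK (by norm_num) ())] at hI
  have hz : zeta (n + 1) (Ysym 1) γ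
      = ∫ s, s * (curvature γ.1 s * (Xsym (n + 1) : VField γ₀).nc γ s) := by
    refine integral_congr_ae (ae_of_all _ fun s => ?_)
    change -(Xsym (n + 1)).bc γ s * 0 + (Xsym (n + 1)).nc γ s * (s * curvature γ.1 s) = _
    ring
  change (1 / (1 - ((n + 1 + 1 : ℕ) : ℝ))) * zeta (n + 1) (Ysym 1) γ = _
  rw [hz, eq_neg_of_add_eq_zero_right hI]
  push_cast
  have h1 : (n : ℝ) + 1 ≠ 0 := by positivity
  have h2 : (1 : ℝ) - (n + 1 + 1) ≠ 0 := by
    have : (0 : ℝ) < n + 1 := by positivity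
    intro h; linarith
  field_simp
  ring

/-! ### First variation of the functionals `I_n`, `n ≥ 2` -/

theorem integral_inner_d₁_tangent {Γ : ℝ → BAL γ₀} {g h : ℝ → ℝ → ℝ} (hp : IsPath Γ g h)
    {Y : VField γ₀} (hg : g 0 = Y.nc (Γ 0)) (hh : h 0 = Y.bc (Γ 0)) (n : ℕ) :
    ∫ s, (inner ℝ (d₁ (fun ε => tangent (Γ ε).1) 0 s) (lax (tangent (Γ 0).1) (n + 1) s) : ℝ)
      = -zeta (n + 1) Y (Γ 0) := by
  have hv := hp.isSphericalVariation
  have hK := hv.weight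
  let a : PathParam := ⟨0, by simp⟩
  have h1 : HasDeg (fun ε : PathParam => curvature (Γ ε).1) 1 (fun ε : PathParam => fun s =>
      (inner ℝ (d₁ (fun ε => (Γ ε).1) ε s)
        (cross (tangent (Γ ε).1 s) (lax (tangent (Γ ε).1) (n + 2) s)) : ℝ)) :=
    (hp.hasDeg_d₁.inner hK.pos (hv.deg.cross hK.pos (hv.hasDeg_lax_succ (n + 1)))).of_le hK
      (by norm_num)
  have h2 : HasDeg (fun ε : PathParam => curvature (Γ ε).1) 1 (fun ε : PathParam => fun s =>
      (inner ℝ (d₁ (fun ε => tangent (Γ ε).1) ε s) (lax (tangent (Γ ε).1) (n + 1) s) : ℝ)) :=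
    (hv.deg_var.inner hK.pos (hv.hasDeg_lax_succ n)).of_le hK (by norm_num)
  -- The derivative of δγ·V_{n+1} is δγ·(T × V_{n+2}) + δT·V_{n+1}. The decay of V_{n+1} removes the
  -- boundary terms although δγ does not decay.
  have hI := (hp.hasDeg_d₁.inner hK.pos (hv.hasDeg_lax_succ n)).integral_deriv_eq_zero hK
    (by norm_num) a (fun s => (hp.hasDerivAt_d₁ 0 s).inner ℝ
      (hasDerivAt_lax (hv.smooth.slice 0) (hv.unit 0) (n + 1) s))
  rw [integral_add (h1.integrable hK le_rfl a) (h2.integrable hK le_rfl a)] at hI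
  rw [zeta_eq, eq_neg_of_add_eq_zero_right hI]
  congr 1
  refine integral_congr_ae (ae_of_all _ fun s => ?_)
  simp only [a]
  rw [hp.d₁_eq_lift hg hh, real_inner_comm]

/-- The functionals `I_n` have the differentials `ζ_n`. -/
theorem actsAs_consMotion (n : ℕ) (Y : VField γ₀) :
    ActsAs Y (consMotion (n + 2)) (zeta (n + 2) Y) := by
  intro Γ g h hp hg hh
  have hv := hp.isSphericalVariation
  have h1 := (hv.hasDerivAt_integral_laxEnergy (n + 1)).const_mul (1 / ((n : ℝ) + 1))
  rw [hv.integral_d₁_laxEnergy, integral_inner_d₁_tangent hp hg hh (n + 1)] at h1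
  simp only [← consMotion_eq] at h1
  refine h1.congr_deriv ?_
  have h2 : (n : ℝ) + 1 ≠ 0 := by positivity
  field_simp

end
end Filament
namespace Filament
noncomputable section

variable {γ₀ : ℝ → E3}

/-! ### The renormalized length -/

theorem tendsto_shift_sub_inner {l : Filter ℝ} {γ : ℝ → E3} {p v : E3} {a α : ℝ}
    (hv : ‖v‖ = 1) (h₀ : Tendsto (fun s => γ₀ s - (p + (s + α) • v)) l (𝓝 0))
    (h : Tendsto (fun s => γ (s + a) - γ₀ s) l (𝓝 0)) :
    Tendsto (fun s => s + a - inner ℝ (γ (s + a) - p) v) l (𝓝 (a - α)) := by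
  have h1 := ((h.add h₀).inner (𝕜 := ℝ) (tendsto_const_nhds (x := v))).const_sub (a - α)
  simp only [add_zero, inner_zero_left, sub_zero] at h1
  refine h1.congr fun s => ?_
  have hvv : inner ℝ v v = (1 : ℝ) := by rw [real_inner_self_eq_norm_sq, hv]; norm_num
  have h2 : γ (s + a) - p = γ (s + a) - γ₀ s + (γ₀ s - (p + (s + α) • v)) + (s + α) • v := by
    abel
  rw [h2, inner_add_left _ ((s + α) • v), inner_smul_left, hvv]
  simp
  ring

/-- Balancing gives convergence without a rate, so 1 - T·v is integrated by monotonicity: it is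
nonnegative and has a primitive with finite limits. -/
theorem integrable_of_hasDerivAt_of_nonneg {f f' : ℝ → ℝ} {m M : ℝ}
    (hf : ∀ s, HasDerivAt f (f' s) s) (hc : Continuous f') (h0 : ∀ s, 0 ≤ f' s)
    (hbot : Tendsto f atBot (𝓝 m)) (htop : Tendsto f atTop (𝓝 M)) : Integrable f' := by
  refine integrable_of_intervalIntegral_norm_tendsto (M - m) (l := atTop)
    (a := fun s : ℝ => -s) (b := fun s : ℝ => s)
    (fun s => (hc.integrableOn_Icc (a := -s) (b := s)).mono_set Set.Ioc_subset_Icc_self)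
    tendsto_neg_atTop_atBot tendsto_id ?_
  have h1 : (fun s : ℝ => ∫ x in (-s)..s, ‖f' x‖) = fun s => f s - f (-s) := by
    funext s
    rw [← intervalIntegral.integral_eq_sub_of_hasDerivAt (fun x _ => hf x)
      (hc.intervalIntegrable _ _)]
    exact intervalIntegral.integral_congr fun x _ => Real.norm_of_nonneg (h0 x)
  rw [h1]
  exact htop.sub (hbot.comp tendsto_neg_atTop_atBot)

/-- Up to an additive constant the renormalized length is the integral of `1 - ⟨T, v⟩`, where `v`
is the asymptotic direction. -/
theorem exists_ell_eq (hγ₀ : IsReferenceCurve γ₀) : ∃ (v : E3) (c : ℝ), ∀ γ : BAL γ₀,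
    Integrable (fun s => (1 : ℝ) - inner ℝ (tangent γ.1 s) v) ∧
    ell γ = c + ∫ s, ((1 : ℝ) - inner ℝ (tangent γ.1 s) v) := by
  obtain ⟨p, v, α, β, hv, htop, hbot⟩ := hγ₀.asymptotic
  refine ⟨v, α - β, fun γ => ?_⟩
  obtain ⟨ha, hb⟩ := Classical.choose_spec γ.2.balanced
  have hell : ell γ = 2 * Classical.choose γ.2.balanced := rfl
  set a := Classical.choose γ.2.balanced
  -- A primitive of 1 - T·v. Its limits a - α and -a - β differ by 2a - (α - β), whence the constant
  -- c = α - β, which depends on the reference curve only.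
  let D : ℝ → ℝ := fun s => s - inner ℝ (γ.1 s - p) v
  have hD : ∀ s, HasDerivAt D (1 - inner ℝ (tangent γ.1 s) v) s := fun s => by
    have h1 := ((hasDerivAt_of_contDiff γ.2.arclength.smooth s).sub_const p).inner ℝ
      (hasDerivAt_const s v)
    refine ((hasDerivAt_id s).sub h1).congr_deriv ?_
    rw [inner_zero_right, zero_add]
    rfl
  have hDtop : Tendsto D atTop (𝓝 (a - α)) := by
    have h1 := (tendsto_shift_sub_inner hv htop ha).comp (tendsto_atTop_add_const_right atTop (-a)
      tendsto_id)
    refine h1.congr fun s => ?_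
    simp [D]
  have hDbot : Tendsto D atBot (𝓝 (-a - β)) := by
    have h1 := (tendsto_shift_sub_inner (a := -a) hv hbot hb).comp
      (tendsto_atBot_add_const_right atBot a tendsto_id)
    refine h1.congr fun s => ?_
    simp [D]
  have hcont : Continuous fun s => (1 : ℝ) - inner ℝ (tangent γ.1 s) v :=
    continuous_const.sub (γ.2.arclength.contDiff_tangent.continuous.inner continuous_const)
  have hI := integrable_of_hasDerivAt_of_nonneg hD hcont (fun s => by
    have h1 := real_inner_le_norm (tangent γ.1 s) v
    rw [hv, tangent, γ.2.arclength.unit_speed, mul_one] at h1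
    exact sub_nonneg.2 h1) hDbot hDtop
  refine ⟨hI, ?_⟩
  rw [integral_of_hasDerivAt_of_tendsto hD hI hDbot hDtop, hell]
  ring

/-- Here the boundary terms survive: T·v tends to 1 at both ends and ∂_s⁻¹(κ g) tends to ±½ ∫ κ g,
so δγ·v increases by ∫ κ g in total. -/
theorem integral_inner_d₁_tangent_const {Γ : ℝ → BAL γ₀} {g h : ℝ → ℝ → ℝ}
    (hp : IsPath Γ g h) {v : E3}
    (hI : Integrable (fun s => (1 : ℝ) - inner ℝ (tangent (Γ 0).1 s) v)) :
    ∫ s, (inner ℝ (d₁ (fun ε => tangent (Γ ε).1) 0 s) v : ℝ)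
      = ∫ s, curvature (Γ 0).1 s * g 0 s := by
  have hv := hp.isSphericalVariation
  have hK := hv.weight
  have hc := hp.isControlled
  let a : PathParam := ⟨0, by simp⟩
  have hvc : HasDeg (fun ε : PathParam => curvature (Γ ε).1) 0 (fun _ _ => v) :=
    HasDeg.const (c := fun _ => v) (C := ‖v‖) fun _ => le_rfl
  have hT' : ∀ s, HasDerivAt (fun s => (1 : ℝ) - inner ℝ (tangent (Γ 0).1 s) v)
      (-inner ℝ (deriv (tangent (Γ 0).1) s) v) s := fun s => by
    refine (((hasDerivAt_of_contDiff (hv.smooth.slice 0) s).inner ℝ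
      (hasDerivAt_const s v)).const_sub 1).congr_deriv ?_
    rw [inner_zero_right, zero_add]
  have hIT' : Integrable (fun s => -(inner ℝ (deriv (tangent (Γ 0).1) s) v : ℝ)) :=
    ((hv.deg_deriv.inner hK.pos hvc).integrable hK (by norm_num) a).neg
  -- Both 1 - T·v and its derivative are integrable, which forces the limit 0.
  have hTtop : Tendsto (fun s => (inner ℝ (tangent (Γ 0).1 s) v : ℝ)) atTop (𝓝 1) := by
    simpa using (tendsto_zero_of_hasDerivAt_of_integrableOn_Ioi (a := 0) (fun s _ => hT' s)
      hIT'.integrableOn hI.integrableOn).const_sub 1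
  have hTbot : Tendsto (fun s => (inner ℝ (tangent (Γ 0).1 s) v : ℝ)) atBot (𝓝 1) := by
    simpa using (tendsto_zero_of_hasDerivAt_of_integrableOn_Iic (a := 0) (fun s _ => hT' s)
      hIT'.integrableOn hI.integrableOn).const_sub 1
  have hκg : Integrable (fun s => curvature (Γ 0).1 s * g 0 s) :=
    hp.hasDeg_kappa_nc.integrable hK (by norm_num) a
  have hN := ((hp.hasDeg_nc.smul hK.pos hc.hasDeg_normal).inner hK.pos hvc)
  have hB := ((hp.hasDeg_bc.smul hK.pos hc.hasDeg_binormal).inner hK.pos hvc)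
  have heq : (fun s => (inner ℝ (d₁ (fun ε => (Γ ε).1) 0 s) v : ℝ)) = fun s =>
      antideriv (fun t => curvature (Γ 0).1 t * g 0 t) s * inner ℝ (tangent (Γ 0).1 s) v
        + inner ℝ (g 0 s • normal (Γ 0).1 s) v + inner ℝ (h 0 s • binormal (Γ 0).1 s) v := by
    funext s
    rw [hp.d₁_eq a, inner_add_left, inner_add_left, inner_smul_left (tangent (Γ a).1 s)]
    rfl
  have htop := (((tendsto_antideriv_atTop hκg).mul hTtop).add
    (hN.tendsto_zero_atTop hK (by norm_num) a)).add (hB.tendsto_zero_atTop hK (by norm_num) a)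
  have hbot := (((tendsto_antideriv_atBot hκg).mul hTbot).add
    (hN.tendsto_zero_atBot hK (by norm_num) a)).add (hB.tendsto_zero_atBot hK (by norm_num) a)
  have hder : ∀ s, HasDerivAt (fun s => (inner ℝ (d₁ (fun ε => (Γ ε).1) 0 s) v : ℝ))
      (inner ℝ (d₁ (fun ε => tangent (Γ ε).1) 0 s) v) s := fun s => by
    refine ((hp.hasDerivAt_d₁ 0 s).inner ℝ (hasDerivAt_const s v)).congr_deriv ?_
    rw [inner_zero_right, zero_add]
  rw [heq] at hder
  rw [integral_of_hasDerivAt_of_tendsto hder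
    ((hv.deg_var.inner hK.pos hvc).integrable hK (by norm_num) a) hbot htop]
  ring

theorem zeta_zero (Y : VField γ₀) (γ : BAL γ₀) :
    zeta 0 Y γ = -∫ s, curvature γ.1 s * Y.nc γ s := by
  rw [← integral_neg]
  refine integral_congr_ae (ae_of_all _ fun s => ?_)
  change -curvature γ.1 s * Y.nc γ s + 0 * Y.bc γ s = _
  ring

/-- The renormalized length has the differential `ζ_0`. -/
theorem actsAs_ell (hγ₀ : IsReferenceCurve γ₀) (Y : VField γ₀) : ActsAs Y ell (zeta 0 Y) := by
  intro Γ g h hp hg hh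
  obtain ⟨v, c, hc⟩ := exists_ell_eq hγ₀
  have hv := hp.isSphericalVariation
  have hK := hv.weight
  have hvc : HasDeg (fun ε : PathParam => curvature (Γ ε).1) 0 (fun _ _ => v) :=
    HasDeg.const (c := fun _ => v) (C := ‖v‖) fun _ => le_rfl
  have hsm : Smooth₂ (fun ε s => (1 : ℝ) - inner ℝ (tangent (Γ ε).1 s) v) :=
    contDiff_const.sub (ContDiff.inner ℝ hv.smooth contDiff_const)
  have hd : d₁ (fun ε s => (1 : ℝ) - inner ℝ (tangent (Γ ε).1 s) v) =
      fun ε s => -inner ℝ (d₁ (fun ε => tangent (Γ ε).1) ε s) v := by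
    funext ε s
    have h1 := ((hv.smooth.hasDerivAt_d₁ ε s).inner ℝ (hasDerivAt_const ε v)).const_sub 1
    rw [inner_zero_right, zero_add] at h1
    exact h1.deriv
  obtain ⟨C, _, hC⟩ := (hv.deg_var.inner hK.pos hvc).rapid hK (by norm_num)
  have h2 := (hasDerivAt_integral_of_bound (C := C) hsm (fun ε hε s => by
    rw [hd, norm_neg]
    exact hC ⟨ε, hε⟩ s) (hc (Γ 0)).1).const_add c
  simp only [hd, integral_neg] at h2
  rw [integral_inner_d₁_tangent_const hp (hc (Γ 0)).1, hg] at h2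
  rw [zeta_zero]
  refine h2.congr_of_eventuallyEq (Eventually.of_forall fun ε => (hc (Γ ε)).2)

/-! ### One-forms and Hamiltonian operators -/

theorem integrable_of_mem_alge {f : ScalarField γ₀} (hf : f ∈ alge γ₀ 2) (γ : BAL γ₀) :
    Integrable (f γ) :=
  (hasDeg_of_mem_alge hf γ).integrable γ.2.isControlled.weight (by norm_num) ()

theorem metric_mem (X Y : VField γ₀) : X.nc * Y.nc + X.bc * Y.bc ∈ alge γ₀ 2 :=
  Submodule.add_mem _ (mul_mem X.2.1 Y.2.1 (by norm_num)) (mul_mem X.2.2 Y.2.2 (by norm_num))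

theorem metric_mem_functionals (X Y : VField γ₀) : metric X Y ∈ functionals γ₀ :=
  Algebra.subset_adjoin (Or.inr ⟨_, metric_mem X Y, rfl⟩)

theorem metric_add_right (X Y Z : VField γ₀) : metric X (Y + Z) = metric X Y + metric X Z := by
  funext γ
  change _ = (∫ s, (X.nc * Y.nc + X.bc * Y.bc : ScalarField γ₀) γ s)
    + ∫ s, (X.nc * Z.nc + X.bc * Z.bc : ScalarField γ₀) γ s
  rw [← integral_add (integrable_of_mem_alge (metric_mem X Y) γ)
    (integrable_of_mem_alge (metric_mem X Z) γ)]
  refine integral_congr_ae (ae_of_all _ fun s => ?_)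
  change X.nc γ s * (Y.nc γ s + Z.nc γ s) + X.bc γ s * (Y.bc γ s + Z.bc γ s)
    = X.nc γ s * Y.nc γ s + X.bc γ s * Y.bc γ s + (X.nc γ s * Z.nc γ s + X.bc γ s * Z.bc γ s)
  ring

theorem metric_fsmul_right (X : VField γ₀) (F : functionals γ₀) (Y : VField γ₀) :
    metric X (fsmul F Y) = F.1 * metric X Y := by
  funext γ
  change _ = F.1 γ * ∫ s, (X.nc * Y.nc + X.bc * Y.bc : ScalarField γ₀) γ s
  rw [← integral_const_mul]
  refine integral_congr_ae (ae_of_all _ fun s => ?_)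
  change X.nc γ s * (F.1 γ * Y.nc γ s) + X.bc γ s * (F.1 γ * Y.bc γ s)
    = F.1 γ * (X.nc γ s * Y.nc γ s + X.bc γ s * Y.bc γ s)
  ring

theorem isOneForm_metric (X : VField γ₀) : IsOneForm (metric X) where
  mem := metric_mem_functionals X
  map_add := metric_add_right X
  map_fsmul := metric_fsmul_right X
  expr := AlgDep.integ (AlgDep.add
    (AlgDep.mul (AlgDep.of_mem_alge X.2.1) (AlgDep.var 0))
    (AlgDep.mul (AlgDep.of_mem_alge X.2.2) (AlgDep.var 1)))

theorem isOneForm_zeta (n : ℕ) : IsOneForm (γ₀ := γ₀) (zeta n) := isOneForm_metric _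

/-- The integrand g² + h² is nonnegative and continuous along each curve, so a vanishing integral
makes it vanish everywhere. -/
theorem eq_zero_of_metric_self_eq_zero {X : VField γ₀} (h : metric X X = 0) : X = 0 := by
  have key : ∀ γ s, X.nc γ s = 0 ∧ X.bc γ s = 0 := by
    intro γ
    have hdeg := hasDeg_of_mem_alge (metric_mem X X) γ
    have hnn : ∀ s, 0 ≤ (X.nc * X.nc + X.bc * X.bc : ScalarField γ₀) γ s := fun s =>
      add_nonneg (mul_self_nonneg (X.nc γ s)) (mul_self_nonneg (X.bc γ s))
    have h1 : ∫ s, (X.nc * X.nc + X.bc * X.bc : ScalarField γ₀) γ s = 0 := congrFun h γ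
    have h2 := (integral_eq_zero_iff_of_nonneg hnn
      (integrable_of_mem_alge (metric_mem X X) γ)).1 h1
    have h3 := (Continuous.ae_eq_iff_eq volume (hdeg.smooth ()).continuous continuous_zero).1 h2
    intro s
    have h4 : X.nc γ s * X.nc γ s + X.bc γ s * X.bc γ s = 0 := congrFun h3 s
    exact ⟨by nlinarith [mul_self_nonneg (X.nc γ s), mul_self_nonneg (X.bc γ s)],
      by nlinarith [mul_self_nonneg (X.nc γ s), mul_self_nonneg (X.bc γ s)]⟩
  refine Subtype.ext (Prod.ext ?_ ?_)
  · exact funext fun γ => funext fun s => (key γ s).1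
  · exact funext fun γ => funext fun s => (key γ s).2

theorem metric_left_cancel {V W : VField γ₀} (h : ∀ X, metric X V = metric X W) : V = W := by
  rw [← sub_eq_zero]
  apply eq_zero_of_metric_self_eq_zero
  have h1 := metric_add_right (V - W) (V - W) W
  rw [sub_add_cancel, h] at h1
  simpa using h1

/-- `Xsym n` satisfies the defining relation because J is orthogonal for the metric; nondegeneracy
identifies it with the field selected by choice. -/
theorem H0_zeta (n : ℕ) : H0 (γ₀ := γ₀) (zeta n) = Xsym n := by
  have hX : ∀ X : VField γ₀, metric X (Xsym n) = -zeta n (J X) := by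
    intro X
    funext γ
    change _ = -∫ s, ((J.symm (Xsym n)).nc * (J X).nc
      + (J.symm (Xsym n)).bc * (J X).bc : ScalarField γ₀) γ s
    rw [← integral_neg]
    refine integral_congr_ae (ae_of_all _ fun s => ?_)
    change X.nc γ s * (Xsym n).nc γ s + X.bc γ s * (Xsym n).bc γ s
      = -(-(Xsym n).bc γ s * X.bc γ s + (Xsym n).nc γ s * -X.nc γ s)
    ring
  have hex : ∃ V : VField γ₀, ∀ X, metric X V = -zeta n (J X) := ⟨_, hX⟩
  rw [H0, dif_pos hex]
  exact metric_left_cancel fun X => (Classical.choose_spec hex X).trans (hX X).symm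

theorem H_zeta (k n : ℕ) : H (γ₀ := γ₀) k (zeta n) = Xsym (k + n) := by
  rw [H, H0_zeta, Xsym, Xsym, Function.iterate_add_apply]

/-- The source of all involution statements: both fields lift to members of the Lax sequence, so the
pairing is one of the vanishing integrals. -/
theorem zeta_Xsym (m n : ℕ) : zeta m (Xsym n : VField γ₀) = 0 := by
  funext γ
  have hc := γ.2.isControlled
  rw [zeta_eq, ← lax_eq_lift]
  exact integral_cross_lax hc.weight hc.hasDeg_tangent hc.hasDeg_deriv_tangent ()
    γ.2.arclength.inner_tangent (m + 1) n

theorem consMotion_mem (n : ℕ) : consMotion n ∈ functionals γ₀ := by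
  cases n with
  | zero => exact Algebra.subset_adjoin (Or.inl rfl)
  | succ n => exact Subalgebra.smul_mem _ (metric_mem_functionals _ _) _

theorem isDifferential_consMotion (hγ₀ : IsReferenceCurve γ₀) {n : ℕ} (hn : n ≠ 1) :
    IsDifferential (γ₀ := γ₀) (consMotion n) (zeta n) := by
  refine ⟨isOneForm_zeta n, fun Y => ?_⟩
  match n, hn with
  | 0, _ => exact actsAs_ell hγ₀ Y
  | n + 2, _ => exact actsAs_consMotion n Y

theorem isHamiltonianField_consMotion (hγ₀ : IsReferenceCurve γ₀) (k : ℕ) {n : ℕ} (hn : n ≠ 1) :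
    IsHamiltonianField (γ₀ := γ₀) k (consMotion n) (Xsym (k + n)) :=
  ⟨zeta n, isDifferential_consMotion hγ₀ hn, H_zeta k n⟩

theorem isPoisson_consMotion (hγ₀ : IsReferenceCurve γ₀) {i j : ℕ} (k : ℕ) (hi : i ≠ 1)
    (hj : j ≠ 1) : IsPoisson (γ₀ := γ₀) k (consMotion i) (consMotion j) 0 := by
  refine ⟨Xsym (k + i), isHamiltonianField_consMotion hγ₀ k hi, ?_⟩
  -- The bracket is ζ_j evaluated on X_{k+i}, so 0 is written in that form.
  rw [← zeta_Xsym j (k + i)]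
  exact (isDifferential_consMotion hγ₀ hj).2 _

theorem consMotion_eq_smul_zeta {n : ℕ} (hn : 2 ≤ n) : (consMotion n : Functional γ₀)
    = (1 / (1 - (n : ℝ))) • zeta (n - 1) (Ysym 1) := by
  obtain ⟨m, rfl⟩ := Nat.exists_eq_add_of_le' (show 1 ≤ n by omega)
  rfl

end
end Filament

theorem theorem11 (γ₀ : ℝ → Filament.E3) (hγ₀ : Filament.IsReferenceCurve γ₀) :
    -- the maps `ζ_n` are 1-forms
    (∀ n : ℕ, Filament.IsOneForm (γ₀ := γ₀) (Filament.zeta n)) ∧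
    -- for `n ≠ 1` they are exact, `ζ_n = dI_n` with an admissible functional `I_n`
    (∀ n : ℕ, n ≠ 1 → Filament.consMotion n ∈ Filament.functionals γ₀ ∧
      Filament.IsDifferential (γ₀ := γ₀) (Filament.consMotion n) (Filament.zeta n)) ∧
    -- the values of the functionals `I_n`
    (Filament.consMotion 0 = (Filament.ell : Filament.Functional γ₀)) ∧
    (∀ n : ℕ, 2 ≤ n → (Filament.consMotion n : Filament.Functional γ₀) =
      (1 / (1 - (n : ℝ))) • Filament.zeta (n - 1) (Filament.Ysym 1)) ∧
    -- they are in involution for the Poisson bracket of every `H_k`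
    (∀ i j k : ℕ, i ≠ 1 → j ≠ 1 → Filament.IsPoisson (γ₀ := γ₀) k
      (Filament.consMotion i) (Filament.consMotion j) 0) ∧
    -- `X_n` is the Hamiltonian vector field `H_0 dI_n`, namely `J grad I_n`
    (∀ n : ℕ, n ≠ 1 →
      Filament.IsHamiltonianField (γ₀ := γ₀) 0 (Filament.consMotion n) (Filament.Xsym n) ∧
      ∃ G : Filament.VField γ₀, Filament.IsGradient (Filament.consMotion n) G ∧
        Filament.Xsym n = Filament.J G) ∧
    -- the formula of Langer and Perline, with convergence of the integral
    (∀ n : ℕ, 2 ≤ n → ∀ γ : Filament.BAL γ₀,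
      MeasureTheory.Integrable
        (Filament.DsInv (Filament.kappa * (Filament.Xsym (n - 1)).nc) γ) ∧
      Filament.consMotion n γ = (1 / ((n : ℝ) - 1)) *
        Filament.integ (Filament.DsInv (Filament.kappa * (Filament.Xsym (n - 1)).nc)) γ) := by
  refine ⟨Filament.isOneForm_zeta, fun n hn => ⟨Filament.consMotion_mem n,
    Filament.isDifferential_consMotion hγ₀ hn⟩, rfl,
    fun n hn => Filament.consMotion_eq_smul_zeta hn,
    fun i j k hi hj => Filament.isPoisson_consMotion hγ₀ k hi hj, fun n hn => ⟨?_, ?_⟩,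
    fun n hn γ => ?_⟩
  · simpa using Filament.isHamiltonianField_consMotion hγ₀ 0 hn
  -- By definition ζ_n is the scalar product with J⁻¹ X_n, so J⁻¹ X_n is the gradient.
  · exact ⟨Filament.J.symm (Filament.Xsym n), (Filament.isDifferential_consMotion hγ₀ hn).2,
      (LinearEquiv.apply_symm_apply _ _).symm⟩
  · obtain ⟨m, rfl⟩ := Nat.exists_eq_add_of_le' hn
    have h1 := Filament.DsInv_kappa_Xsym (m + 1) γ
    rw [show m + 2 - 1 = m + 1 by omega]
    refine ⟨?_, ?_⟩
    · rw [h1]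
      exact (Filament.hasDeg_laxEnergy_tangent (m + 1) γ).integrable
        γ.2.isControlled.weight le_rfl ()
    · rw [Filament.integ, h1, Filament.consMotion_eq]
      push_cast
      ring
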